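/- Consider a plant $\dot x_p = A_p x_p + B_p u + E_p w_p$, $y_p = C_p x_p + D_p u$ and a reference model $\dot x_r = A_r x_r + E_r w_r$, $y_r = C_r x_r$ (real matrices of compatible sizes). Under the delayed state feedback $u(t) = K_p x_p(t-\nu(t)) + K_r x_r(t-\nu(t))$, with a measurable delay $0<\eta_m \le \nu(t) \le \kappa$, the state $x=[x_p^T,x_r^T]^T$, the disturbance $w=[w_p^T,w_r^T]^T$ and the tracking error $e=y_p-y_r$ satisfy $$\dot x(t)=\bar A x(t)+\bar B x(t-\nu(t))+\bar E w(t),\qquad e(t)=\bar C x(t)+\bar D x(t-\nu(t)),\qquad t\ge 0,$$ with $\bar A=\mathrm{diag}(A_p,A_r)$, $\bar E=\mathrm{diag}(E_p,E_r)$, $\bar B=\begin{bmatrix}B_pK_p&B_pK_r\\0&0\end{bmatrix}$, $\bar C=[C_p,\,-C_r]$, $\bar D=[D_pK_p,\,D_pK_r]$. Let $\gamma>0$ and $\widetilde B=[B_p^T,0]^T$. Suppose that there are symmetric positive definite matrices $\bar P,\bar Q,\bar M_1,\bar M_2$ and matrices $\bar U_1,\bar U_2,\bar V_1,\bar V_2,\bar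 K$ such that the symmetric block matrix $$\begin{bmatrix} \Theta_{11} & -\bar U_1+\bar V_1^T & \widetilde B\bar K & \bar U_1 & 0 & \bar E & \bar P\bar C^T & \bar P\bar A^T & \bar P\bar A^T\\ \ast & \Theta_{22} & -\bar U_2+\bar V_2^T & \bar V_1 & \bar U_2 & 0&0&0&0\\ \ast&\ast& -\bar V_2^T-\bar V_2 & 0 & \bar V_2 & 0 & \bar K^TD_p^T & \bar K^T\widetilde B^T & \bar K^T\widetilde B^T\\ \ast&\ast&\ast& \eta_m^{-1}\Upsilon_1 &0&0&0&0&0\\ \ast&\ast&\ast&\ast& \kappa^{-1}\Upsilon_2&0&0&0&0\\ \ast&\ast&\ast&\ast&\ast& -\gamma^2 I & 0 & \bar E^T & \bar E^T\\ \ast&\ast&\ast&\ast&\ast&\ast& -I&0&0\\ \ast&\ast&\ast&\ast&\ast&\ast&\ast& -\eta_m^{-1}\bar M_1 & 0\\ \ast&\ast&\ast&\ast&\ast&\ast&\ast&\ast& -\kappa^{-1}\bar M_2 \end{bmatrix}$$ is negative definite, where $\Theta_{11}=\bar A\bar P+\bar P\bar A^T+\bar Q+\bar U_1^T+\bar U_1$,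 $\Theta_{22}=-\bar Q-\bar V_1^T-\bar V_1+\bar U_2^T+\bar U_2$ and $\Upsilon_i=\bar M_i-2\bar P$. Then with the gain $[K_p,K_r]=\bar K\bar P^{-1}$, for every such delay $\nu$, the closed loop attains the output tracking performance $\gamma$ in the $H_\infty$ sense: for $w=0$ it is asymptotically stable (the zero solution is Lyapunov stable and the solution with any continuous initial function on $[-\kappa,0]$ tends to $0$), and under the zero initial condition, for every $w\in L^2[0,\infty)$, one has $e\in L^2[0,\infty)$, and if $w\neq 0$ then $\|e\|_2<\gamma\|w\|_2$. -/

import Mathlib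

open MeasureTheory Matrix

/-- The coefficient matrices of the plant
`x_p' = A_p x_p + B_p u + E_p w_p`, `y_p = C_p x_p + D_p u`
and of the reference model
`x_r' = A_r x_r + E_r w_r`, `y_r = C_r x_r`. -/
structure TrackingData (np nr m dp dr q : ℕ) where
  Ap : Matrix (Fin np) (Fin np) ℝ
  Bp : Matrix (Fin np) (Fin m) ℝ
  Ep : Matrix (Fin np) (Fin dp) ℝ
  Cp : Matrix (Fin q) (Fin np) ℝ
  Dp : Matrix (Fin q) (Fin m) ℝ
  Ar : Matrix (Fin nr) (Fin nr) ℝ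
  Er : Matrix (Fin nr) (Fin dr) ℝ
  Cr : Matrix (Fin q) (Fin nr) ℝ

namespace TrackingData

variable {np nr m dp dr q : ℕ}

/-- `Ā = diag(A_p, A_r)`. -/
def ABar (S : TrackingData np nr m dp dr q) : Matrix (Fin np ⊕ Fin nr) (Fin np ⊕ Fin nr) ℝ :=
  fromBlocks S.Ap 0 0 S.Ar

/-- `Ē = diag(E_p, E_r)`. -/
def EBar (S : TrackingData np nr m dp dr q) : Matrix (Fin np ⊕ Fin nr) (Fin dp ⊕ Fin dr) ℝ :=
  fromBlocks S.Ep 0 0 S.Er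

/-- `C̄ = [C_p, -C_r]`. -/
def CBar (S : TrackingData np nr m dp dr q) : Matrix (Fin q) (Fin np ⊕ Fin nr) ℝ :=
  fromCols S.Cp (-S.Cr)

/-- `B̃ = [B_pᵀ, 0]ᵀ`. -/
def BTilde (S : TrackingData np nr m dp dr q) : Matrix (Fin np ⊕ Fin nr) (Fin m) ℝ :=
  fromRows S.Bp 0

/-- `B̄ = [[B_p K_p, B_p K_r], [0, 0]]`. -/
def BBar (S : TrackingData np nr m dp dr q)
    (Kp : Matrix (Fin m) (Fin np) ℝ) (Kr : Matrix (Fin m) (Fin nr) ℝ) :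
    Matrix (Fin np ⊕ Fin nr) (Fin np ⊕ Fin nr) ℝ :=
  fromBlocks (S.Bp * Kp) (S.Bp * Kr) 0 0

/-- `D̄ = [D_p K_p, D_p K_r]`. -/
def DBar (S : TrackingData np nr m dp dr q)
    (Kp : Matrix (Fin m) (Fin np) ℝ) (Kr : Matrix (Fin m) (Fin nr) ℝ) :
    Matrix (Fin q) (Fin np ⊕ Fin nr) ℝ :=
  fromCols (S.Dp * Kp) (S.Dp * Kr)

/-- The right-hand side `Ā x(t) + B̄ x(t - ν(t)) + Ē w(t)` of the augmented closed loop. -/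
def rhs (S : TrackingData np nr m dp dr q)
    (Kp : Matrix (Fin m) (Fin np) ℝ) (Kr : Matrix (Fin m) (Fin nr) ℝ) (ν : ℝ → ℝ)
    (w : ℝ → Fin dp ⊕ Fin dr → ℝ) (x : ℝ → Fin np ⊕ Fin nr → ℝ) (t : ℝ) :
    Fin np ⊕ Fin nr → ℝ :=
  S.ABar *ᵥ x t + S.BBar Kp Kr *ᵥ x (t - ν t) + S.EBar *ᵥ w t

/-- The tracking error `e(t) = y_p(t) - y_r(t) = C̄ x(t) + D̄ x(t - ν(t))`. -/
def trackingError (S : TrackingData np nr m dp dr q)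
    (Kp : Matrix (Fin m) (Fin np) ℝ) (Kr : Matrix (Fin m) (Fin nr) ℝ) (ν : ℝ → ℝ)
    (x : ℝ → Fin np ⊕ Fin nr → ℝ) (t : ℝ) : Fin q → ℝ :=
  S.CBar *ᵥ x t + S.DBar Kp Kr *ᵥ x (t - ν t)

/-- `x : [-κ, ∞) → ℝⁿ` is a (Carathéodory) solution of the augmented closed loop
`x'(t) = Ā x(t) + B̄ x(t - ν(t)) + Ē w(t)`, `t ≥ 0`, whose initial function is the continuous
function `x|_[-κ, 0]`: on `[0, ∞)` it is locally absolutely continuous and the equation holds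
almost everywhere, written in integrated form. Values of `x` on `(-∞, -κ)` play no role. -/
structure IsSolution (S : TrackingData np nr m dp dr q)
    (Kp : Matrix (Fin m) (Fin np) ℝ) (Kr : Matrix (Fin m) (Fin nr) ℝ) (κ : ℝ) (ν : ℝ → ℝ)
    (w : ℝ → Fin dp ⊕ Fin dr → ℝ) (x : ℝ → Fin np ⊕ Fin nr → ℝ) : Prop where
  continuousOn : ContinuousOn x (Set.Ici (-κ))
  intervalIntegrable : ∀ t, 0 ≤ t → IntervalIntegrable (S.rhs Kp Kr ν w x) volume 0 t
  integral_eq : ∀ t, 0 ≤ t → x t = x 0 + ∫ s in (0 : ℝ)..t, S.rhs Kp Kr ν w x s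

/-- Asymptotic stability of the augmented closed loop without disturbance: the zero solution is
Lyapunov stable, and every solution, whatever its initial function, tends to `0`. -/
def AsymptoticallyStable (S : TrackingData np nr m dp dr q)
    (Kp : Matrix (Fin m) (Fin np) ℝ) (Kr : Matrix (Fin m) (Fin nr) ℝ) (κ : ℝ) (ν : ℝ → ℝ) :
    Prop :=
  (∀ ε : ℝ, 0 < ε → ∃ δ : ℝ, 0 < δ ∧ ∀ x : ℝ → Fin np ⊕ Fin nr → ℝ,
    S.IsSolution Kp Kr κ ν 0 x → (∀ t ∈ Set.Icc (-κ) 0, ‖x t‖ < δ) → ∀ t, 0 ≤ t → ‖x t‖ < ε) ∧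
  (∀ x : ℝ → Fin np ⊕ Fin nr → ℝ, S.IsSolution Kp Kr κ ν 0 x →
    Filter.Tendsto x Filter.atTop (nhds 0))

/-- Output tracking performance `γ` in the `H∞` sense: the closed loop is asymptotically stable
without disturbance, and, under the zero initial condition, every disturbance `w` in
`L²[0, ∞)` gives a tracking error `e` in `L²[0, ∞)`, with `‖e‖₂ < γ ‖w‖₂` when `w ≠ 0`
(written as `∫ eᵀ e < γ² ∫ wᵀ w`). -/
def HasTrackingPerformance (S : TrackingData np nr m dp dr q)
    (Kp : Matrix (Fin m) (Fin np) ℝ) (Kr : Matrix (Fin m) (Fin nr) ℝ) (κ : ℝ) (ν : ℝ → ℝ)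
    (γ : ℝ) : Prop :=
  S.AsymptoticallyStable Kp Kr κ ν ∧
  ∀ (w : ℝ → Fin dp ⊕ Fin dr → ℝ) (x : ℝ → Fin np ⊕ Fin nr → ℝ),
    MemLp w 2 (volume.restrict (Set.Ici 0)) →
    S.IsSolution Kp Kr κ ν w x →
    (∀ t ∈ Set.Icc (-κ) 0, x t = 0) →
    MemLp (S.trackingError Kp Kr ν x) 2 (volume.restrict (Set.Ici 0)) ∧
    (¬ w =ᵐ[volume.restrict (Set.Ici 0)] 0 →
      ∫ t in Set.Ici (0 : ℝ), S.trackingError Kp Kr ν x t ⬝ᵥ S.trackingError Kp Kr ν x t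
        < γ ^ 2 * ∫ t in Set.Ici (0 : ℝ), w t ⬝ᵥ w t)

end TrackingData

/-- A block row `[B₁ B₂ … B₉]`. -/
abbrev blockRow {r c₁ c₂ c₃ c₄ c₅ c₆ c₇ c₈ c₉ : Type*}
    (B₁ : Matrix r c₁ ℝ) (B₂ : Matrix r c₂ ℝ) (B₃ : Matrix r c₃ ℝ)
    (B₄ : Matrix r c₄ ℝ) (B₅ : Matrix r c₅ ℝ) (B₆ : Matrix r c₆ ℝ)
    (B₇ : Matrix r c₇ ℝ) (B₈ : Matrix r c₈ ℝ) (B₉ : Matrix r c₉ ℝ) :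
    Matrix r (c₁ ⊕ c₂ ⊕ c₃ ⊕ c₄ ⊕ c₅ ⊕ c₆ ⊕ c₇ ⊕ c₈ ⊕ c₉) ℝ :=
  fromCols B₁ (fromCols B₂ (fromCols B₃ (fromCols B₄ (fromCols B₅
    (fromCols B₆ (fromCols B₇ (fromCols B₈ B₉)))))))

/-- Nine block rows stacked on top of each other. -/
abbrev stackRows {c r₁ r₂ r₃ r₄ r₅ r₆ r₇ r₈ r₉ : Type*}
    (R₁ : Matrix r₁ c ℝ) (R₂ : Matrix r₂ c ℝ) (R₃ : Matrix r₃ c ℝ)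
    (R₄ : Matrix r₄ c ℝ) (R₅ : Matrix r₅ c ℝ) (R₆ : Matrix r₆ c ℝ)
    (R₇ : Matrix r₇ c ℝ) (R₈ : Matrix r₈ c ℝ) (R₉ : Matrix r₉ c ℝ) :
    Matrix (r₁ ⊕ r₂ ⊕ r₃ ⊕ r₄ ⊕ r₅ ⊕ r₆ ⊕ r₇ ⊕ r₈ ⊕ r₉) c ℝ :=
  fromRows R₁ (fromRows R₂ (fromRows R₃ (fromRows R₄ (fromRows R₅
    (fromRows R₆ (fromRows R₇ (fromRows R₈ R₉)))))))

namespace TrackingData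

/-- The symmetric 9 × 9 block matrix of the linear matrix inequality, with
`Θ₁₁ = Ā P̄ + P̄ Āᵀ + Q̄ + Ū₁ᵀ + Ū₁`, `Θ₂₂ = -Q̄ - V̄₁ᵀ - V̄₁ + Ū₂ᵀ + Ū₂` and
`Υᵢ = M̄ᵢ - 2 P̄`. -/
noncomputable def lmiMatrix {np nr m dp dr q : ℕ} (S : TrackingData np nr m dp dr q) (ηm κ γ : ℝ)
    (P Q M₁ M₂ U₁ U₂ V₁ V₂ : Matrix (Fin np ⊕ Fin nr) (Fin np ⊕ Fin nr) ℝ)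
    (K : Matrix (Fin m) (Fin np ⊕ Fin nr) ℝ) :
    Matrix
      ((Fin np ⊕ Fin nr) ⊕ (Fin np ⊕ Fin nr) ⊕ (Fin np ⊕ Fin nr) ⊕ (Fin np ⊕ Fin nr) ⊕
        (Fin np ⊕ Fin nr) ⊕ (Fin dp ⊕ Fin dr) ⊕ Fin q ⊕ (Fin np ⊕ Fin nr) ⊕ (Fin np ⊕ Fin nr))
      ((Fin np ⊕ Fin nr) ⊕ (Fin np ⊕ Fin nr) ⊕ (Fin np ⊕ Fin nr) ⊕ (Fin np ⊕ Fin nr) ⊕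
        (Fin np ⊕ Fin nr) ⊕ (Fin dp ⊕ Fin dr) ⊕ Fin q ⊕ (Fin np ⊕ Fin nr) ⊕ (Fin np ⊕ Fin nr))
      ℝ :=
  let A := S.ABar
  let B := S.BTilde
  let C := S.CBar
  let D := S.Dp
  let E := S.EBar
  let Θ₁₁ := A * P + P * Aᵀ + Q + U₁ᵀ + U₁
  let Θ₂₂ := -Q - V₁ᵀ - V₁ + U₂ᵀ + U₂
  let Υ₁ := M₁ - (2 : ℝ) • P
  let Υ₂ := M₂ - (2 : ℝ) • P
  stackRows
    (blockRow Θ₁₁ (-U₁ + V₁ᵀ) (B * K) U₁ 0 E (P * Cᵀ) (P * Aᵀ) (P * Aᵀ))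
    (blockRow (-U₁ + V₁ᵀ)ᵀ Θ₂₂ (-U₂ + V₂ᵀ) V₁ U₂ 0 0 0 0)
    (blockRow (B * K)ᵀ (-U₂ + V₂ᵀ)ᵀ (-V₂ᵀ - V₂) 0 V₂ 0 (Kᵀ * Dᵀ) (Kᵀ * Bᵀ) (Kᵀ * Bᵀ))
    (blockRow U₁ᵀ V₁ᵀ 0 (ηm⁻¹ • Υ₁) 0 0 0 0 0)
    (blockRow 0 U₂ᵀ V₂ᵀ 0 (κ⁻¹ • Υ₂) 0 0 0 0)
    (blockRow Eᵀ 0 0 0 0 (-(γ ^ 2 • 1)) 0 Eᵀ Eᵀ)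
    (blockRow (P * Cᵀ)ᵀ 0 (Kᵀ * Dᵀ)ᵀ 0 0 0 (-1) 0 0)
    (blockRow (P * Aᵀ)ᵀ 0 (Kᵀ * Bᵀ)ᵀ 0 0 E 0 (-(ηm⁻¹ • M₁)) 0)
    (blockRow (P * Aᵀ)ᵀ 0 (Kᵀ * Bᵀ)ᵀ 0 0 E 0 0 (-(κ⁻¹ • M₂)))

end TrackingData

/-! ### Quadratic forms on finite-dimensional real vectors -/

section QuadraticForms

variable {n : Type*} [Fintype n]

/-! The proof rests on the Lyapunov–Krasovskii functional V(t) = xᵀXx + ∫_{t-ηm}^t xᵀQ̂x +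
ηm∫_{-ηm}^0∫_{t+s}^t ẋᵀR₁ẋ + κ∫_{-κ}^0∫_{t+s}^t ẋᵀR₂ẋ, with X = P⁻¹, Q̂ = P⁻¹QP⁻¹, Rᵢ = Mᵢ⁻¹.

Algebra (`exists_dissipative`): the LMI is tested on one vector built from P⁻¹x(t), P⁻¹x(t-ηm),
P⁻¹x(t-ν) and their differences. The free weights Uᵢ, Vᵢ cancel on it, the last three slots are
chosen as in a Schur complement, and M - 2P ≥ -PM⁻¹P replaces Υᵢ by the terms that Jensen's
inequality produces. Coercivity of the negated LMI leaves a margin c(‖x‖² + ‖w‖²).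

Analysis (`lyapunovKrasovskii_energy_inequality`): solutions are only absolutely continuous, so V is
never differentiated. Each of its terms is integrated over [a, T] and its nonnegative value at T is
dropped, except xᵀXx. Jensen is applied on [t-ηm, t] and [t-ν, t-ηm], so no regularity of ν beyond
measurability is needed.

Conclusions: with a = 0 and zero initial data, V(0) = 0 and the energy inequality gives the gain;
the margin c∫‖w‖² makes it strict. For stability the initial function is merely continuous, so V(0)
may be meaningless; a = κ is used instead, after a Grönwall bound on [0, κ]. This yields uniform and
L² bounds, and `tendsto_zero_of_lipschitz_of_integral_bounded` gives convergence to zero. -/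

lemma norm_sq_le_dotProduct_self (v : n → ℝ) : ‖v‖ ^ 2 ≤ v ⬝ᵥ v := by
  have h : ‖v‖ ≤ √(v ⬝ᵥ v) := by
    refine (pi_norm_le_iff_of_nonneg (Real.sqrt_nonneg _)).2 fun i => ?_
    refine Real.abs_le_sqrt ?_
    rw [sq]
    exact Finset.single_le_sum (f := fun i => v i * v i)
      (fun i _ => mul_self_nonneg (v i)) (Finset.mem_univ i)
  calc ‖v‖ ^ 2 ≤ √(v ⬝ᵥ v) ^ 2 := by gcongr
    _ = v ⬝ᵥ v := Real.sq_sqrt (Finset.sum_nonneg fun i _ => mul_self_nonneg (v i))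

/-- A matrix defines a bounded bilinear form for the supremum norm. -/
lemma exists_abs_dotProduct_mulVec_le (N : Matrix n n ℝ) :
    ∃ C : ℝ, 0 ≤ C ∧ ∀ u v : n → ℝ, |u ⬝ᵥ (N *ᵥ v)| ≤ C * (‖u‖ * ‖v‖) := by
  refine ⟨∑ i, ∑ j, |N i j|, by positivity, fun u v => ?_⟩
  simp only [dotProduct, mulVec, Finset.mul_sum, Finset.sum_mul]
  refine (Finset.abs_sum_le_sum_abs _ _).trans (Finset.sum_le_sum fun i _ => ?_)
  refine (Finset.abs_sum_le_sum_abs _ _).trans (Finset.sum_le_sum fun j _ => ?_)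
  rw [abs_mul, abs_mul]
  have hu : |u i| ≤ ‖u‖ := norm_le_pi_norm u i
  have hv : |v j| ≤ ‖v‖ := norm_le_pi_norm v j
  calc |u i| * (|N i j| * |v j|) = |N i j| * (|u i| * |v j|) := by ring
    _ ≤ |N i j| * (‖u‖ * ‖v‖) := by gcongr

lemma exists_norm_mulVec_le {m : Type*} [Fintype m] (N : Matrix m n ℝ) :
    ∃ C : ℝ, 0 ≤ C ∧ ∀ v : n → ℝ, ‖N *ᵥ v‖ ≤ C * ‖v‖ :=
  ⟨‖(mulVecLin N).toContinuousLinearMap‖, norm_nonneg _,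
    fun v => (mulVecLin N).toContinuousLinearMap.le_opNorm v⟩

/-- The form attains a positive minimum on the compact unit sphere, and homogeneity carries it to
all vectors. -/
lemma Matrix.PosDef.exists_coercive {N : Matrix n n ℝ} (hN : N.PosDef) :
    ∃ c : ℝ, 0 < c ∧ ∀ v : n → ℝ, c * ‖v‖ ^ 2 ≤ v ⬝ᵥ (N *ᵥ v) := by
  have hpos : ∀ v : n → ℝ, v ≠ 0 → 0 < v ⬝ᵥ (N *ᵥ v) := fun v hv => by
    simpa using hN.dotProduct_mulVec_pos hv
  have hcont : Continuous fun v : n → ℝ => v ⬝ᵥ (N *ᵥ v) := by fun_prop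
  -- An empty sphere means that every vector is zero, so any constant serves.
  rcases (Metric.sphere (0 : n → ℝ) 1).eq_empty_or_nonempty with h | h
  · refine ⟨1, one_pos, fun v => ?_⟩
    rcases eq_or_ne v 0 with rfl | hv
    · simp
    · have : ‖v‖⁻¹ • v ∈ Metric.sphere (0 : n → ℝ) 1 := by
        simp [norm_smul, norm_ne_zero_iff.2 hv]
      simp [h] at this
  · obtain ⟨v₀, hv₀, hmin⟩ := (isCompact_sphere (0 : n → ℝ) 1).exists_isMinOn h hcont.continuousOn
    have hv₀' : v₀ ≠ 0 := by
      rintro rfl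
      simp at hv₀
    refine ⟨_, hpos v₀ hv₀', fun v => ?_⟩
    rcases eq_or_ne v 0 with rfl | hv
    · simp
    · have hn : ‖v‖ ≠ 0 := norm_ne_zero_iff.2 hv
      have hmem : ‖v‖⁻¹ • v ∈ Metric.sphere (0 : n → ℝ) 1 := by
        simp [norm_smul, hn]
      have h1 := isMinOn_iff.1 hmin _ hmem
      simp only [mulVec_smul, smul_dotProduct, dotProduct_smul, smul_eq_mul] at h1
      calc v₀ ⬝ᵥ (N *ᵥ v₀) * ‖v‖ ^ 2
          ≤ ‖v‖⁻¹ * (‖v‖⁻¹ * v ⬝ᵥ (N *ᵥ v)) * ‖v‖ ^ 2 := by gcongr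
        _ = v ⬝ᵥ (N *ᵥ v) := by field_simp

lemma Matrix.PosDef.transpose_eq {n : Type*} {N : Matrix n n ℝ} (hN : N.PosDef) : Nᵀ = N := by
  simpa using hN.isHermitian.eq

lemma Matrix.PosDef.dotProduct_mulVec_nonneg' {N : Matrix n n ℝ} (hN : N.PosDef) (v : n → ℝ) :
    0 ≤ v ⬝ᵥ (N *ᵥ v) := by
  simpa using hN.posSemidef.dotProduct_mulVec_nonneg v

lemma Matrix.PosDef.dotProduct_mulVec_comm {N : Matrix n n ℝ} (hN : N.PosDef) (u v : n → ℝ) :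
    u ⬝ᵥ (N *ᵥ v) = v ⬝ᵥ (N *ᵥ u) := by
  conv_lhs => rw [← hN.transpose_eq]
  exact dotProduct_transpose_mulVec N u v

/-- `M - 2P ≥ -P M⁻¹ P`, as quadratic forms. -/
lemma Matrix.PosDef.neg_inv_le_sub_two [DecidableEq n] {M P : Matrix n n ℝ} (hM : M.PosDef)
    (v : n → ℝ) :
    -((P *ᵥ v) ⬝ᵥ (M⁻¹ *ᵥ (P *ᵥ v))) ≤ v ⬝ᵥ (M *ᵥ v) - 2 * v ⬝ᵥ (P *ᵥ v) := by
  -- Completing the square: the form of M at v - M⁻¹Pv expands to vᵀMv - 2vᵀPv + (Pv)ᵀM⁻¹(Pv).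
  have h := hM.dotProduct_mulVec_nonneg' (v - M⁻¹ *ᵥ (P *ᵥ v))
  have hinv : M *ᵥ (M⁻¹ *ᵥ (P *ᵥ v)) = P *ᵥ v := by
    rw [mulVec_mulVec, mul_nonsing_inv _ ((isUnit_iff_isUnit_det _).1 hM.isUnit), one_mulVec]
  rw [mulVec_sub, hinv, sub_dotProduct, dotProduct_sub, dotProduct_sub,
    hM.dotProduct_mulVec_comm (M⁻¹ *ᵥ (P *ᵥ v)) v, hinv,
    dotProduct_comm (M⁻¹ *ᵥ (P *ᵥ v)) (P *ᵥ v)] at h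
  linarith

end QuadraticForms

/-! ### From the matrix inequality to pointwise dissipation -/

namespace TrackingData

variable {np nr m dp dr q : ℕ} (S : TrackingData np nr m dp dr q)

/-- The value of the quadratic form of the LMI at the vectors for which the free weighting
matrices cancel. -/
lemma dotProduct_lmiMatrix_mulVec {ηm κ γ : ℝ}
    {P Q M₁ M₂ U₁ U₂ V₁ V₂ : Matrix (Fin np ⊕ Fin nr) (Fin np ⊕ Fin nr) ℝ}
    {K : Matrix (Fin m) (Fin np ⊕ Fin nr) ℝ} (hP : Pᵀ = P)
    (ξ ζ ω g₁ g₂ : Fin np ⊕ Fin nr → ℝ) (w : Fin dp ⊕ Fin dr → ℝ) (e : Fin q → ℝ) :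
    (Sum.elim ξ (Sum.elim ζ (Sum.elim ω (Sum.elim (ζ - ξ) (Sum.elim (ω - ζ) (Sum.elim w
      (Sum.elim e (Sum.elim g₁ g₂)))))))) ⬝ᵥ
      (S.lmiMatrix ηm κ γ P Q M₁ M₂ U₁ U₂ V₁ V₂ K *ᵥ
        (Sum.elim ξ (Sum.elim ζ (Sum.elim ω (Sum.elim (ζ - ξ) (Sum.elim (ω - ζ) (Sum.elim w
          (Sum.elim e (Sum.elim g₁ g₂))))))))) =
      2 * ξ ⬝ᵥ (S.ABar *ᵥ (P *ᵥ ξ) + S.BTilde *ᵥ (K *ᵥ ω) + S.EBar *ᵥ w)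
      + ξ ⬝ᵥ (Q *ᵥ ξ) - ζ ⬝ᵥ (Q *ᵥ ζ)
      + ηm⁻¹ * ((ζ - ξ) ⬝ᵥ (M₁ *ᵥ (ζ - ξ)) - 2 * (ζ - ξ) ⬝ᵥ (P *ᵥ (ζ - ξ)))
      + κ⁻¹ * ((ω - ζ) ⬝ᵥ (M₂ *ᵥ (ω - ζ)) - 2 * (ω - ζ) ⬝ᵥ (P *ᵥ (ω - ζ)))
      - γ ^ 2 * w ⬝ᵥ w
      + 2 * e ⬝ᵥ (S.CBar *ᵥ (P *ᵥ ξ) + S.Dp *ᵥ (K *ᵥ ω)) - e ⬝ᵥ e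
      + 2 * g₁ ⬝ᵥ (S.ABar *ᵥ (P *ᵥ ξ) + S.BTilde *ᵥ (K *ᵥ ω) + S.EBar *ᵥ w)
      - ηm⁻¹ * g₁ ⬝ᵥ (M₁ *ᵥ g₁)
      + 2 * g₂ ⬝ᵥ (S.ABar *ᵥ (P *ᵥ ξ) + S.BTilde *ᵥ (K *ᵥ ω) + S.EBar *ᵥ w)
      - κ⁻¹ * g₂ ⬝ᵥ (M₂ *ᵥ g₂) := by
  have hA : P * S.ABarᵀ = (S.ABar * P)ᵀ := by rw [transpose_mul, hP]
  have hC : P * S.CBarᵀ = (S.CBar * P)ᵀ := by rw [transpose_mul, hP]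
  have hB : Kᵀ * S.BTildeᵀ = (S.BTilde * K)ᵀ := by rw [transpose_mul]
  have hD : Kᵀ * S.Dpᵀ = (S.Dp * K)ᵀ := by rw [transpose_mul]
  simp only [lmiMatrix, hA, hC, hB, hD, fromRows_mulVec, fromCols_mulVec, Sum.elim_comp_inl,
    Sum.elim_comp_inr, sumElim_dotProduct_sumElim, transpose_transpose, transpose_add,
    transpose_neg]
  -- The differences stay atomic while transposes are moved across the dot products. Once they are
  -- expanded again, the weights cancel in pairs such as 2ξᵀU₁(ξ - ζ) + 2ξᵀU₁(ζ - ξ).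
  generalize hp : ζ - ξ = p
  generalize hr : ω - ζ = r
  simp only [add_mulVec, sub_mulVec, neg_mulVec, zero_mulVec, dotProduct_add,
    dotProduct_sub, dotProduct_neg, dotProduct_zero, one_mulVec, smul_mulVec, dotProduct_smul,
    smul_eq_mul, dotProduct_transpose_mulVec, ← mulVec_mulVec]
  subst hp hr
  simp only [mulVec_sub, sub_dotProduct, dotProduct_sub]
  ring

/-- The pointwise dissipation inequality of the closed loop with respect to the weights `X`, `Qh`,
`R₁`, `R₂` of a Lyapunov–Krasovskii functional, in terms of the state `x`, the delayed states `y`,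
`z` and the disturbance `w`. -/
def Dissipative (Kp : Matrix (Fin m) (Fin np) ℝ) (Kr : Matrix (Fin m) (Fin nr) ℝ) (ηm κ γ c : ℝ)
    (X Qh R₁ R₂ : Matrix (Fin np ⊕ Fin nr) (Fin np ⊕ Fin nr) ℝ) : Prop :=
  ∀ (x y z f : Fin np ⊕ Fin nr → ℝ) (w : Fin dp ⊕ Fin dr → ℝ) (e : Fin q → ℝ),
    f = S.ABar *ᵥ x + S.BBar Kp Kr *ᵥ z + S.EBar *ᵥ w →
    e = S.CBar *ᵥ x + S.DBar Kp Kr *ᵥ z →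
    c * ‖x‖ ^ 2 + c * ‖w‖ ^ 2 + e ⬝ᵥ e - γ ^ 2 * w ⬝ᵥ w + 2 * x ⬝ᵥ (X *ᵥ f)
      + x ⬝ᵥ (Qh *ᵥ x) - y ⬝ᵥ (Qh *ᵥ y)
      + ηm * f ⬝ᵥ (R₁ *ᵥ f) + κ * f ⬝ᵥ (R₂ *ᵥ f)
      - ηm⁻¹ * (x - y) ⬝ᵥ (R₁ *ᵥ (x - y)) - κ⁻¹ * (y - z) ⬝ᵥ (R₂ *ᵥ (y - z)) ≤ 0

/-- The LMI yields a dissipation inequality for the closed loop. -/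
lemma exists_dissipative {ηm κ γ : ℝ} (hηm : 0 < ηm) (hκ : 0 < κ)
    {P Q M₁ M₂ U₁ U₂ V₁ V₂ : Matrix (Fin np ⊕ Fin nr) (Fin np ⊕ Fin nr) ℝ}
    {K : Matrix (Fin m) (Fin np ⊕ Fin nr) ℝ}
    (hP : P.PosDef) (hM₁ : M₁.PosDef) (hM₂ : M₂.PosDef)
    (hLMI : (-(S.lmiMatrix ηm κ γ P Q M₁ M₂ U₁ U₂ V₁ V₂ K)).PosDef)
    {Kp : Matrix (Fin m) (Fin np) ℝ} {Kr : Matrix (Fin m) (Fin nr) ℝ}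
    (hK : fromCols Kp Kr = K * P⁻¹) :
    ∃ c : ℝ, 0 < c ∧ S.Dissipative Kp Kr ηm κ γ c P⁻¹ (P⁻¹ * Q * P⁻¹) M₁⁻¹ M₂⁻¹ := by
  obtain ⟨c, hc, hcoer⟩ := hLMI.exists_coercive
  obtain ⟨CP, hCP0, hCP⟩ := exists_norm_mulVec_le P
  have hdet : IsUnit P.det := (isUnit_iff_isUnit_det _).1 hP.isUnit
  have hB : ∀ v, S.BBar Kp Kr *ᵥ v = S.BTilde *ᵥ (K *ᵥ (P⁻¹ *ᵥ v)) := by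
    have : S.BBar Kp Kr = S.BTilde * (K * P⁻¹) := by
      rw [← hK, BTilde, fromRows_mul, mul_fromCols, BBar, Matrix.zero_mul,
        ← fromRows_fromCols_eq_fromBlocks, fromCols_zero]
    intro v
    rw [this]
    simp only [← mulVec_mulVec]
  have hD : ∀ v, S.DBar Kp Kr *ᵥ v = S.Dp *ᵥ (K *ᵥ (P⁻¹ *ᵥ v)) := by
    have : S.DBar Kp Kr = S.Dp * (K * P⁻¹) := by
      rw [← hK, mul_fromCols, DBar]
    intro v
    rw [this]
    simp only [← mulVec_mulVec]
  have hPP : ∀ v, P *ᵥ (P⁻¹ *ᵥ v) = v := fun v => by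
    rw [mulVec_mulVec, mul_nonsing_inv _ hdet, one_mulVec]
  have hMM : ∀ {M : Matrix (Fin np ⊕ Fin nr) (Fin np ⊕ Fin nr) ℝ}, M.PosDef →
      ∀ v, M *ᵥ (M⁻¹ *ᵥ v) = v := fun {M} hM v => by
    rw [mulVec_mulVec, mul_nonsing_inv _ ((isUnit_iff_isUnit_det _).1 hM.isUnit), one_mulVec]
  have hd : 0 < (CP + 1) ^ 2 + 1 := by positivity
  -- Below, ‖x‖ ≤ (CP + 1)‖v‖ and ‖w‖ ≤ ‖v‖ for the test vector v, so this constant makes the two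
  -- margin terms at most (c/2)‖v‖².
  refine ⟨c / (2 * ((CP + 1) ^ 2 + 1)), by positivity, fun x y z f w e hf he => ?_⟩
  set ξ := P⁻¹ *ᵥ x with hξ
  set ζ := P⁻¹ *ᵥ y with hζ
  set ω := P⁻¹ *ᵥ z with hω
  -- The last three slots maximise the form: 2eᵀe' - e'ᵀe' at e' = e, and 2gᵀf - h⁻¹gᵀMg at g =
  -- hM⁻¹f, with values eᵀe and h·fᵀM⁻¹f. This is the Schur complement taken by hand.
  have key := S.dotProduct_lmiMatrix_mulVec (ηm := ηm) (κ := κ) (γ := γ) (Q := Q) (M₁ := M₁)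
    (M₂ := M₂) (U₁ := U₁) (U₂ := U₂) (V₁ := V₁) (V₂ := V₂) (K := K) hP.transpose_eq ξ ζ ω
    (ηm • M₁⁻¹ *ᵥ f) (κ • M₂⁻¹ *ᵥ f) w e
  have hv := hcoer (Sum.elim ξ (Sum.elim ζ (Sum.elim ω (Sum.elim (ζ - ξ) (Sum.elim (ω - ζ)
    (Sum.elim w (Sum.elim e (Sum.elim (ηm • M₁⁻¹ *ᵥ f) (κ • M₂⁻¹ *ᵥ f)))))))))
  rw [neg_mulVec, dotProduct_neg, key] at hv
  clear key
  set v := Sum.elim ξ (Sum.elim ζ (Sum.elim ω (Sum.elim (ζ - ξ) (Sum.elim (ω - ζ)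
    (Sum.elim w (Sum.elim e (Sum.elim (ηm • M₁⁻¹ *ᵥ f) (κ • M₂⁻¹ *ᵥ f)))))))) with hvdef
  have hξv : ‖ξ‖ ≤ ‖v‖ := (pi_norm_le_iff_of_nonneg (norm_nonneg _)).2 fun i =>
    norm_le_pi_norm v (Sum.inl i)
  have hwv : ‖w‖ ≤ ‖v‖ := (pi_norm_le_iff_of_nonneg (norm_nonneg _)).2 fun i =>
    norm_le_pi_norm v (Sum.inr (Sum.inr (Sum.inr (Sum.inr (Sum.inr (Sum.inl i))))))
  have hf' : S.ABar *ᵥ (P *ᵥ ξ) + S.BTilde *ᵥ (K *ᵥ ω) + S.EBar *ᵥ w = f := by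
    rw [hf, hB, hξ, hPP]
  have he' : S.CBar *ᵥ (P *ᵥ ξ) + S.Dp *ᵥ (K *ᵥ ω) = e := by
    rw [he, hD, hξ, hPP]
  rw [hf', he'] at hv
  have hxv : ‖x‖ ≤ (CP + 1) * ‖v‖ := by
    calc ‖x‖ = ‖P *ᵥ ξ‖ := by rw [hξ, hPP]
      _ ≤ CP * ‖ξ‖ := hCP _
      _ ≤ (CP + 1) * ‖v‖ := by gcongr; linarith
  have hnorm : c / (2 * ((CP + 1) ^ 2 + 1)) * ‖x‖ ^ 2 + c / (2 * ((CP + 1) ^ 2 + 1)) * ‖w‖ ^ 2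
      ≤ c * ‖v‖ ^ 2 := by
    calc _ ≤ c / (2 * ((CP + 1) ^ 2 + 1)) * ((CP + 1) * ‖v‖) ^ 2
          + c / (2 * ((CP + 1) ^ 2 + 1)) * ‖v‖ ^ 2 := by gcongr
      _ = c / 2 * ‖v‖ ^ 2 := by field_simp
      _ ≤ c * ‖v‖ ^ 2 := by
        have := sq_nonneg ‖v‖
        nlinarith
  have h1 := hM₁.neg_inv_le_sub_two (P := P) (ζ - ξ)
  have h2 := hM₂.neg_inv_le_sub_two (P := P) (ω - ζ)
  have e1 : P *ᵥ (ζ - ξ) = -(x - y) := by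
    rw [mulVec_sub, hζ, hξ, hPP, hPP, neg_sub]
  have e2 : P *ᵥ (ω - ζ) = -(y - z) := by
    rw [mulVec_sub, hζ, hω, hPP, hPP, neg_sub]
  have h1' := mul_le_mul_of_nonneg_left h1 (inv_pos.2 hηm).le
  have h2' := mul_le_mul_of_nonneg_left h2 (inv_pos.2 hκ).le
  rw [e1] at h1'
  rw [e2] at h2'
  rw [e1, e2] at hv
  simp only [mulVec_neg, dotProduct_neg, neg_dotProduct, neg_neg, mulVec_smul, hMM hM₁, hMM hM₂,
    smul_dotProduct, dotProduct_smul, smul_eq_mul] at hv h1' h2'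
  have e3 : ξ ⬝ᵥ f = x ⬝ᵥ (P⁻¹ *ᵥ f) := by
    rw [hP.inv.dotProduct_mulVec_comm, dotProduct_comm]
  have e4 : ∀ u, u ⬝ᵥ ((P⁻¹ * Q * P⁻¹) *ᵥ u) = (P⁻¹ *ᵥ u) ⬝ᵥ (Q *ᵥ (P⁻¹ *ᵥ u)) := fun u => by
    rw [← mulVec_mulVec, ← mulVec_mulVec, hP.inv.dotProduct_mulVec_comm, dotProduct_comm]
  rw [e4, e4, ← e3, ← hξ, ← hζ]
  rw [dotProduct_comm (M₁⁻¹ *ᵥ f) f, dotProduct_comm (M₂⁻¹ *ᵥ f) f] at hv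
  have s1 : ηm⁻¹ * (ηm * (ηm * f ⬝ᵥ (M₁⁻¹ *ᵥ f))) = ηm * f ⬝ᵥ (M₁⁻¹ *ᵥ f) := by field_simp
  have s2 : κ⁻¹ * (κ * (κ * f ⬝ᵥ (M₂⁻¹ *ᵥ f))) = κ * f ⬝ᵥ (M₂⁻¹ *ᵥ f) := by field_simp
  simp only [s1, s2] at hv
  linarith

end TrackingData

/-! ### Integral calculus for the Lyapunov–Krasovskii functional -/

section Calculus

open Set intervalIntegral

/-- Leibniz rule, in integrated form, for two primitives of integrable functions. -/
lemma integral_mul_add_mul_of_primitive {F₁ F₂ g₁ g₂ : ℝ → ℝ} {a b : ℝ} (hab : a ≤ b)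
    (hg₁ : IntervalIntegrable g₁ volume a b) (hg₂ : IntervalIntegrable g₂ volume a b)
    (hF₁ : ∀ t ∈ Icc a b, F₁ t = F₁ a + ∫ s in a..t, g₁ s)
    (hF₂ : ∀ t ∈ Icc a b, F₂ t = F₂ a + ∫ s in a..t, g₂ s) :
    ∫ t in a..b, (g₁ t * F₂ t + F₁ t * g₂ t) = F₁ b * F₂ b - F₁ a * F₂ a := by
  -- The primitives are absolutely continuous, so integration by parts holds for them; their
  -- derivatives agree with the integrands almost everywhere by Lebesgue differentiation.
  have hac : ∀ (c : ℝ) {g : ℝ → ℝ}, IntervalIntegrable g volume a b →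
      AbsolutelyContinuousOnInterval (fun t => c + ∫ s in a..t, g s) a b := fun c g hg =>
    (LipschitzOnWith.absolutelyContinuousOnInterval (K := 0)
      (LipschitzWith.const c).lipschitzOnWith).add
      (hg.absolutelyContinuousOnInterval_intervalIntegral left_mem_uIcc)
  have h := (hac (F₁ a) hg₁).integral_deriv_mul_eq_sub (hac (F₂ a) hg₂)
  rw [hF₁ b (right_mem_Icc.2 hab), hF₂ b (right_mem_Icc.2 hab)]
  simp only [integral_same, add_zero] at h
  rw [← h]
  refine integral_congr_ae ?_
  filter_upwards [hg₁.ae_hasDerivAt_integral, hg₂.ae_hasDerivAt_integral] with t h₁ h₂ ht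
  have ht' : t ∈ uIcc a b := uIoc_subset_uIcc ht
  have ht'' : t ∈ Icc a b := by rwa [uIcc_of_le hab] at ht'
  rw [((h₁ ht' a left_mem_uIcc).const_add (F₁ a)).deriv,
    ((h₂ ht' a left_mem_uIcc).const_add (F₂ a)).deriv, hF₁ t ht'', hF₂ t ht'']

lemma IntervalIntegrable.fun_sum {ι : Type*} (s : Finset ι) {f : ι → ℝ → ℝ} {a b : ℝ}
    (hf : ∀ i ∈ s, IntervalIntegrable (f i) volume a b) :
    IntervalIntegrable (fun t => ∑ i ∈ s, f i t) volume a b :=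
  ⟨integrable_finsetSum s fun i hi => (hf i hi).1, integrable_finsetSum s fun i hi => (hf i hi).2⟩

variable {n : Type*} [Fintype n]

lemma IntervalIntegrable.eval_pi {g : ℝ → n → ℝ} {a b : ℝ}
    (hg : IntervalIntegrable g volume a b) (i : n) :
    IntervalIntegrable (fun t => g t i) volume a b :=
  ⟨(ContinuousLinearMap.proj (R := ℝ) (φ := fun _ : n => ℝ) i).integrable_comp hg.1,
    (ContinuousLinearMap.proj (R := ℝ) (φ := fun _ : n => ℝ) i).integrable_comp hg.2⟩

lemma intervalIntegral_eval_pi {g : ℝ → n → ℝ} {a b : ℝ}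
    (hg : IntervalIntegrable g volume a b) (i : n) :
    (∫ t in a..b, g t) i = ∫ t in a..b, g t i :=
  ((ContinuousLinearMap.proj (R := ℝ) (φ := fun _ : n => ℝ) i).intervalIntegral_comp_comm hg).symm

lemma IntervalIntegrable.continuous_dotProduct_mulVec {g x : ℝ → n → ℝ} {a b : ℝ}
    (hg : IntervalIntegrable g volume a b) (hx : Continuous x) (N : Matrix n n ℝ) :
    IntervalIntegrable (fun t => x t ⬝ᵥ (N *ᵥ g t)) volume a b := by
  simp only [dotProduct_mulVec]
  refine IntervalIntegrable.fun_sum (f := fun i t => (x t ᵥ* N) i * g t i) Finset.univ fun i _ => ?_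
  exact (hg.eval_pi i).continuousOn_mul (by fun_prop)

/-- The derivative of a quadratic form along a primitive, in integrated form. -/
lemma integral_two_mul_dotProduct_mulVec {x g : ℝ → n → ℝ} {a b : ℝ} (hab : a ≤ b)
    (hx : Continuous x) (hg : IntervalIntegrable g volume a b)
    (hxg : ∀ t ∈ Icc a b, x t - x a = ∫ s in a..t, g s) {X : Matrix n n ℝ} (hX : Xᵀ = X) :
    ∫ t in a..b, 2 * x t ⬝ᵥ (X *ᵥ g t) = x b ⬝ᵥ (X *ᵥ x b) - x a ⬝ᵥ (X *ᵥ x a) := by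
  have hsub : ∀ t ∈ Icc a b, IntervalIntegrable g volume a t := fun t ht =>
    hg.mono_set (by rw [uIcc_of_le ht.1, uIcc_of_le hab]; exact Icc_subset_Icc_right ht.2)
  have hx1 : ∀ i, ∀ t ∈ Icc a b, x t i = x a i + ∫ s in a..t, g s i := fun i t ht => by
    rw [← intervalIntegral_eval_pi (hsub t ht), ← hxg t ht]
    simp
  have hij : ∀ i j, ∫ t in a..b, (g t i * x t j + x t i * g t j) = x b i * x b j - x a i * x a j :=
    fun i j => integral_mul_add_mul_of_primitive hab (hg.eval_pi i) (hg.eval_pi j) (hx1 i) (hx1 j)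
  have hint : ∀ i j, IntervalIntegrable (fun t => g t i * x t j + x t i * g t j) volume a b :=
    fun i j => ((hg.eval_pi i).mul_continuousOn (by fun_prop)).add
      ((hg.eval_pi j).continuousOn_mul (by fun_prop))
  have expand : ∀ u v : n → ℝ, u ⬝ᵥ (X *ᵥ v) = ∑ i, ∑ j, X i j * (u i * v j) := fun u v => by
    simp only [dotProduct, mulVec, Finset.mul_sum]
    exact Finset.sum_congr rfl fun i _ => Finset.sum_congr rfl fun j _ => by ring
  have hsymm : ∀ u v : n → ℝ, u ⬝ᵥ (X *ᵥ v) = v ⬝ᵥ (X *ᵥ u) := fun u v => by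
    conv_lhs => rw [← hX]
    exact dotProduct_transpose_mulVec X u v
  -- Symmetry of X splits the factor 2 into gᵀXx + xᵀXg, to which the Leibniz rule applies entry by
  -- entry.
  have hfun : ∀ t, 2 * x t ⬝ᵥ (X *ᵥ g t)
      = ∑ i, ∑ j, X i j * (g t i * x t j + x t i * g t j) := fun t => by
    rw [two_mul]
    nth_rewrite 1 [hsymm]
    rw [expand, expand, ← Finset.sum_add_distrib]
    refine Finset.sum_congr rfl fun i _ => ?_
    rw [← Finset.sum_add_distrib]
    exact Finset.sum_congr rfl fun j _ => by ring
  simp only [hfun]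
  rw [intervalIntegral.integral_finsetSum fun i _ =>
    IntervalIntegrable.fun_sum (f := fun j t => X i j * (g t i * x t j + x t i * g t j)) _
      fun j _ => (hint i j).const_mul _]
  rw [expand, expand, ← Finset.sum_sub_distrib]
  refine Finset.sum_congr rfl fun i _ => ?_
  rw [intervalIntegral.integral_finsetSum fun j _ => (hint i j).const_mul _,
    ← Finset.sum_sub_distrib]
  refine Finset.sum_congr rfl fun j _ => ?_
  rw [intervalIntegral.integral_const_mul, hij]
  ring

/-- Jensen's inequality for a positive definite quadratic form. -/
lemma inv_mul_dotProduct_integral_le {g : ℝ → n → ℝ} {s t h : ℝ} (hst : s ≤ t) (hh : 0 < h)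
    (hth : t - s ≤ h) {R : Matrix n n ℝ} (hR : R.PosDef) (hg : IntervalIntegrable g volume s t)
    (hφ : IntervalIntegrable (fun τ => g τ ⬝ᵥ (R *ᵥ g τ)) volume s t) :
    h⁻¹ * (∫ τ in s..t, g τ) ⬝ᵥ (R *ᵥ ∫ τ in s..t, g τ) ≤ ∫ τ in s..t, g τ ⬝ᵥ (R *ᵥ g τ) := by
  set G := ∫ τ in s..t, g τ with hG
  have hlin : ∫ τ in s..t, G ⬝ᵥ (R *ᵥ g τ) = G ⬝ᵥ (R *ᵥ G) := by
    simp only [dotProduct_mulVec G]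
    simp only [dotProduct]
    rw [intervalIntegral.integral_finsetSum fun i _ => (hg.eval_pi i).const_mul _]
    refine Finset.sum_congr rfl fun i _ => ?_
    rw [intervalIntegral.integral_const_mul, ← intervalIntegral_eval_pi hg]
  have hlini : IntervalIntegrable (fun τ => G ⬝ᵥ (R *ᵥ g τ)) volume s t :=
    hg.continuous_dotProduct_mulVec (x := fun _ => G) continuous_const R
  -- Expansion of the nonnegative form at g(τ) - h⁻¹G. Integration gives the factor 2h⁻¹ - (t -
  -- s)h⁻² ≥ h⁻¹, so h need only bound the length of the interval.
  have hpt : ∀ τ ∈ Icc s t, 2 * h⁻¹ * G ⬝ᵥ (R *ᵥ g τ) - h⁻¹ ^ 2 * G ⬝ᵥ (R *ᵥ G)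
      ≤ g τ ⬝ᵥ (R *ᵥ g τ) := fun τ _ => by
    have := hR.dotProduct_mulVec_nonneg' (g τ - h⁻¹ • G)
    simp only [mulVec_sub, mulVec_smul, dotProduct_sub, sub_dotProduct, dotProduct_smul,
      smul_dotProduct, smul_eq_mul, hR.dotProduct_mulVec_comm (g τ) G] at this
    nlinarith
  have hmono := intervalIntegral.integral_mono_on hst
    ((hlini.const_mul (2 * h⁻¹)).sub intervalIntegrable_const) hφ hpt
  rw [intervalIntegral.integral_sub (hlini.const_mul _) intervalIntegrable_const,
    intervalIntegral.integral_const_mul, hlin, intervalIntegral.integral_const, smul_eq_mul] at hmono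
  have hGG := hR.dotProduct_mulVec_nonneg' G
  have : (t - s) * (h⁻¹ ^ 2 * G ⬝ᵥ (R *ᵥ G)) ≤ h⁻¹ * G ⬝ᵥ (R *ᵥ G) := by
    calc (t - s) * (h⁻¹ ^ 2 * G ⬝ᵥ (R *ᵥ G)) ≤ h * (h⁻¹ ^ 2 * G ⬝ᵥ (R *ᵥ G)) := by gcongr
      _ = h⁻¹ * G ⬝ᵥ (R *ᵥ G) := by field_simp
  linarith

/-- Lower bound for the change along `[a, T]` of `∫_{-h}^0 ∫_{t+s}^t φ`. -/
lemma neg_mul_integral_le_integral_sub_window {φ : ℝ → ℝ} {a T h : ℝ} (hh : 0 ≤ h)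
    (hφ0 : ∀ t, 0 ≤ φ t) (hφ : ∀ s t, IntervalIntegrable φ volume s t) :
    -(h * ∫ t in (a - h)..a, φ t)
      ≤ ∫ t in a..T, (h * φ t - ∫ s in (t - h)..t, φ s) := by
  set Φ : ℝ → ℝ := fun t => ∫ s in a..t, φ s with hΦ
  have hΦc : Continuous Φ := continuous_primitive hφ a
  have hwin : ∀ s t, ∫ τ in s..t, φ τ = Φ t - Φ s := fun s t =>
    (integral_interval_sub_left (hφ a t) (hφ a s)).symm
  have hmono : Monotone Φ := fun s t hst => by
    have := integral_nonneg (μ := volume) hst fun u _ => hφ0 u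
    rw [hwin] at this
    linarith
  have hi : ∀ s t, IntervalIntegrable Φ volume s t := fun s t => hΦc.intervalIntegrable s t
  have hi' : IntervalIntegrable (fun t => Φ (t - h)) volume a T :=
    Continuous.intervalIntegrable (by fun_prop) _ _
  -- The right side is W(T) - W(a) with W(t) = hΦ(t) - ∫_{t-h}^t Φ, the double integral.
  -- Monotonicity of Φ gives W(T) ≥ 0 and W(a) ≤ h(Φ(a) - Φ(a - h)).
  have h1 : ∫ t in a..T, (h * φ t - ∫ s in (t - h)..t, φ s)
      = h * (Φ T - Φ a) - (∫ t in (T - h)..T, Φ t) + ∫ t in (a - h)..a, Φ t := by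
    simp only [hwin]
    rw [intervalIntegral.integral_sub ((hφ a T).const_mul h) ((hi a T).sub hi'),
      intervalIntegral.integral_sub (hi a T) hi', intervalIntegral.integral_const_mul,
      hwin, intervalIntegral.integral_comp_sub_right (fun t => Φ t) h,
      integral_interval_sub_interval_comm' (hi _ _) (hi _ _) (hi _ _)]
    ring
  have h2 : ∫ t in (T - h)..T, Φ t ≤ h * Φ T := by
    have := integral_mono_on (μ := volume) (by linarith : T - h ≤ T) (hi _ _)
      (intervalIntegrable_const (c := Φ T)) fun t ht => hmono ht.2
    simpa using this
  have h3 : h * Φ (a - h) ≤ ∫ t in (a - h)..a, Φ t := by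
    have := integral_mono_on (μ := volume) (by linarith : a - h ≤ a)
      (intervalIntegrable_const (c := Φ (a - h))) (hi _ _) fun t ht => hmono ht.1
    simpa using this
  rw [h1, hwin]
  linarith

/-- Lower bound for the change along `[a, T]` of `∫_{t-h}^t q`. -/
lemma neg_integral_le_integral_sub_shift {q : ℝ → ℝ} {a T h : ℝ} (hh : 0 ≤ h)
    (hq0 : ∀ t, 0 ≤ q t) (hq : Continuous q) :
    -(∫ t in (a - h)..a, q t) ≤ ∫ t in a..T, (q t - q (t - h)) := by
  have hi : ∀ s t, IntervalIntegrable q volume s t := fun s t => hq.intervalIntegrable s t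
  rw [intervalIntegral.integral_sub (hi _ _) (Continuous.intervalIntegrable (by fun_prop) _ _),
    intervalIntegral.integral_comp_sub_right (fun t => q t) h,
    integral_interval_sub_interval_comm' (hi _ _) (hi _ _) (hi _ _)]
  -- The integral telescopes to the window ending at T minus the window ending at a; the former is
  -- discarded.
  have := integral_nonneg (μ := volume) (by linarith : T - h ≤ T) fun u _ => hq0 u
  linarith

/-- The Lyapunov–Krasovskii energy inequality, integrated from `a` to `T`. -/
lemma lyapunovKrasovskii_energy_inequality {x g : ℝ → n → ℝ} {ν s : ℝ → ℝ}
    {a T η κ : ℝ} {X Qh R₁ R₂ : Matrix n n ℝ} (haT : a ≤ T) (hη : 0 < η) (hηκ : η ≤ κ)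
    (hX : X.PosDef) (hQ : Qh.PosDef) (hR₁ : R₁.PosDef) (hR₂ : R₂.PosDef)
    (hx : Continuous x) (hg : ∀ s t, IntervalIntegrable g volume s t)
    (hφ₁ : ∀ s t, IntervalIntegrable (fun τ => g τ ⬝ᵥ (R₁ *ᵥ g τ)) volume s t)
    (hφ₂ : ∀ s t, IntervalIntegrable (fun τ => g τ ⬝ᵥ (R₂ *ᵥ g τ)) volume s t)
    (hxg : ∀ s t, a - κ ≤ s → a - κ ≤ t → x t - x s = ∫ τ in s..t, g τ)
    (hν : ∀ t, a ≤ t → η ≤ ν t ∧ ν t ≤ κ)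
    (hs : IntervalIntegrable s volume a T)
    (hdiss : ∀ t, a < t → s t + 2 * x t ⬝ᵥ (X *ᵥ g t)
        + x t ⬝ᵥ (Qh *ᵥ x t) - x (t - η) ⬝ᵥ (Qh *ᵥ x (t - η))
        + η * g t ⬝ᵥ (R₁ *ᵥ g t) + κ * g t ⬝ᵥ (R₂ *ᵥ g t)
        - η⁻¹ * (x t - x (t - η)) ⬝ᵥ (R₁ *ᵥ (x t - x (t - η)))
        - κ⁻¹ * (x (t - η) - x (t - ν t)) ⬝ᵥ (R₂ *ᵥ (x (t - η) - x (t - ν t))) ≤ 0) :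
    x T ⬝ᵥ (X *ᵥ x T) + ∫ t in a..T, s t ≤ x a ⬝ᵥ (X *ᵥ x a)
      + (∫ t in (a - η)..a, x t ⬝ᵥ (Qh *ᵥ x t))
      + η * (∫ t in (a - η)..a, g t ⬝ᵥ (R₁ *ᵥ g t))
      + κ * (∫ t in (a - κ)..a, g t ⬝ᵥ (R₂ *ᵥ g t)) := by
  have hκ : 0 < κ := hη.trans_le hηκ
  have hq : Continuous fun t => x t ⬝ᵥ (Qh *ᵥ x t) := by fun_prop
  have b1 := integral_two_mul_dotProduct_mulVec haT hx (hg a T)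
    (fun t ht => hxg a t (by linarith) (by linarith [ht.1])) hX.transpose_eq
  have b2 := neg_integral_le_integral_sub_shift (a := a) (T := T) hη.le
    (fun t => hQ.dotProduct_mulVec_nonneg' (x t)) hq
  have b3 := neg_mul_integral_le_integral_sub_window (a := a) (T := T) hη.le
    (fun t => hR₁.dotProduct_mulVec_nonneg' (g t)) hφ₁
  have b4 := neg_mul_integral_le_integral_sub_window (a := a) (T := T) hκ.le
    (fun t => hR₂.dotProduct_mulVec_nonneg' (g t)) hφ₂
  have i1 : IntervalIntegrable (fun t => 2 * x t ⬝ᵥ (X *ᵥ g t)) volume a T :=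
    ((hg a T).continuous_dotProduct_mulVec hx X).const_mul 2
  have i2 : IntervalIntegrable (fun t => x t ⬝ᵥ (Qh *ᵥ x t) - x (t - η) ⬝ᵥ (Qh *ᵥ x (t - η)))
      volume a T := Continuous.intervalIntegrable (by fun_prop) _ _
  have iwin : ∀ {φ : ℝ → ℝ} (h : ℝ), (∀ s t, IntervalIntegrable φ volume s t) →
      IntervalIntegrable (fun t => h * φ t - ∫ τ in (t - h)..t, φ τ) volume a T := by
    intro φ h hφ
    refine ((hφ a T).const_mul h).sub (Continuous.intervalIntegrable ?_ _ _)
    have : (fun t => ∫ τ in (t - h)..t, φ τ)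
        = fun t => (∫ τ in a..t, φ τ) - ∫ τ in a..(t - h), φ τ := by
      ext t
      exact (integral_interval_sub_left (hφ _ _) (hφ _ _)).symm
    rw [this]
    have hc := continuous_primitive hφ a
    fun_prop
  have i3 := iwin η hφ₁
  have i4 := iwin κ hφ₂
  -- Jensen's inequality trades the difference terms of the dissipation inequality for the integrals
  -- that arise from the double integrals of the functional.
  have hpt : ∀ t ∈ Ioo a T, s t + 2 * x t ⬝ᵥ (X *ᵥ g t)
      + (x t ⬝ᵥ (Qh *ᵥ x t) - x (t - η) ⬝ᵥ (Qh *ᵥ x (t - η)))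
      + (η * g t ⬝ᵥ (R₁ *ᵥ g t) - ∫ τ in (t - η)..t, g τ ⬝ᵥ (R₁ *ᵥ g τ))
      + (κ * g t ⬝ᵥ (R₂ *ᵥ g t) - ∫ τ in (t - κ)..t, g τ ⬝ᵥ (R₂ *ᵥ g τ)) ≤ 0 := by
    intro t ht
    have hd := hdiss t ht.1
    obtain ⟨hν1, hν2⟩ := hν t ht.1.le
    have j1 := inv_mul_dotProduct_integral_le (by linarith : t - η ≤ t) hη (by linarith) hR₁
      (hg _ _) (hφ₁ _ _)
    rw [← hxg _ _ (by linarith [ht.1]) (by linarith [ht.1])] at j1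
    have j2 := inv_mul_dotProduct_integral_le (by linarith : t - ν t ≤ t - η) hκ (by linarith) hR₂
      (hg _ _) (hφ₂ _ _)
    rw [← hxg _ _ (by linarith [ht.1]) (by linarith [ht.1])] at j2
    -- The time-dependent interval sits inside the fixed window [t - κ, t], and the integrand is
    -- nonnegative.
    have j3 : ∫ τ in (t - ν t)..(t - η), g τ ⬝ᵥ (R₂ *ᵥ g τ)
        ≤ ∫ τ in (t - κ)..t, g τ ⬝ᵥ (R₂ *ᵥ g τ) :=
      integral_mono_interval (by linarith) (by linarith) (by linarith)
        (Filter.Eventually.of_forall fun τ => hR₂.dotProduct_mulVec_nonneg' (g τ)) (hφ₂ _ _)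
    linarith
  have hfin := integral_mono_on_of_le_Ioo haT ((((hs.add i1).add i2).add i3).add i4)
    (intervalIntegrable_const (c := (0 : ℝ))) hpt
  rw [intervalIntegral.integral_add (((hs.add i1).add i2).add i3) i4,
    intervalIntegral.integral_add ((hs.add i1).add i2) i3,
    intervalIntegral.integral_add (hs.add i1) i2, intervalIntegral.integral_add hs i1, b1,
    intervalIntegral.integral_const, smul_zero] at hfin
  linarith

end Calculus

/-! ### Convergence to zero and a Grönwall bound with delay -/

section Decay

open Set Filter Topology intervalIntegral

variable {E : Type*} [NormedAddCommGroup E]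

/-- A version of Barbalat's lemma. -/
lemma tendsto_zero_of_lipschitz_of_integral_bounded {x : ℝ → E} {a L I : ℝ} (hL : 0 ≤ L)
    (hx : Continuous x) (hlip : ∀ s t, a ≤ s → s ≤ t → ‖x t - x s‖ ≤ L * (t - s))
    (hI : ∀ T, a ≤ T → ∫ t in a..T, ‖x t‖ ^ 2 ≤ I) : Tendsto x atTop (𝓝 0) := by
  have hc : Continuous fun t => ‖x t‖ ^ 2 := by fun_prop
  have hii : ∀ s t, IntervalIntegrable (fun t => ‖x t‖ ^ 2) volume s t := fun s t =>
    hc.intervalIntegrable s t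
  have hint : IntegrableOn (fun t => ‖x t‖ ^ 2) (Ioi a) := by
    refine integrableOn_Ioi_of_intervalIntegral_norm_bounded (b := fun T : ℝ => T) (l := atTop) I a
      (fun T => (hc.integrableOn_Icc (a := a) (b := T)).mono_set Ioc_subset_Icc_self) tendsto_id ?_
    filter_upwards [eventually_ge_atTop a] with T hT
    simpa using hI T hT
  have hlim := intervalIntegral_tendsto_integral_Ioi a hint tendsto_id
  rw [tendsto_zero_iff_norm_tendsto_zero, Metric.tendsto_atTop]
  intro ε hε
  -- If ‖x(T)‖ ≥ ε, then ‖x‖ ≥ ε/2 on [T, T + δ], so the integral there is at least δ(ε/2)², against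
  -- the vanishing tails. L + 1 avoids division by zero.
  set δ := ε / (2 * (L + 1)) with hδ
  have hδ0 : 0 < δ := by positivity
  have hshift : Tendsto (fun T : ℝ => T + δ) atTop atTop :=
    tendsto_atTop_add_const_right _ _ tendsto_id
  have hdiff : Tendsto (fun T : ℝ => ∫ t in T..(T + δ), ‖x t‖ ^ 2) atTop (𝓝 0) := by
    have := (hlim.comp hshift).sub hlim
    rw [sub_self] at this
    refine this.congr fun T => ?_
    exact integral_interval_sub_left (hii _ _) (hii _ _)
  have hev := hdiff.eventually_lt_const (show 0 < δ * (ε / 2) ^ 2 by positivity)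
  obtain ⟨N, hN⟩ := eventually_atTop.1 (hev.and (eventually_ge_atTop a))
  refine ⟨N, fun T hT => ?_⟩
  obtain ⟨h1, h2⟩ := hN T hT
  by_contra! hcon
  rw [Real.dist_eq, sub_zero, abs_norm] at hcon
  have hlow : ∀ t ∈ Icc T (T + δ), (ε / 2) ^ 2 ≤ ‖x t‖ ^ 2 := fun t ht => by
    have hl := hlip T t h2 ht.1
    have hLδ : L * (t - T) ≤ ε / 2 := by
      calc L * (t - T) ≤ (L + 1) * δ := by
            gcongr
            · linarith [ht.1]
            · linarith
            · linarith [ht.2]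
        _ = ε / 2 := by rw [hδ]; field_simp
    have := norm_le_norm_add_norm_sub' (x T) (x t)
    rw [norm_sub_rev] at this
    gcongr
    linarith
  have := integral_mono_on (μ := volume) (by linarith : T ≤ T + δ)
    (intervalIntegrable_const (c := (ε / 2) ^ 2)) (hii _ _) hlow
  simp only [intervalIntegral.integral_const, smul_eq_mul, add_sub_cancel_left] at this
  linarith

variable [NormedSpace ℝ E]

/-- A Grönwall bound for a linear delay differential inequality on a bounded time interval. -/
lemma norm_le_of_delay_inequality {x r : ℝ → E} {ν : ℝ → ℝ} {κ T α β δ : ℝ}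
    (hα : 0 ≤ α) (hβ : 0 ≤ β) (hδ : 0 ≤ δ) (hκ : 0 ≤ κ) (hx : Continuous x)
    (hxr : ∀ t, 0 ≤ t → x t = x 0 + ∫ s in (0 : ℝ)..t, r s)
    (hr : ∀ s, 0 ≤ s → ‖r s‖ ≤ α * ‖x s‖ + β * ‖x (s - ν s)‖)
    (hν : ∀ t, 0 ≤ t → 0 ≤ ν t ∧ ν t ≤ κ) (hinit : ∀ t ∈ Icc (-κ) 0, ‖x t‖ ≤ δ)
    {t : ℝ} (ht : t ∈ Icc 0 T) :
    ‖x t‖ ≤ 2 * (1 + β * T) * Real.exp ((2 * (α + β) + 1) * T) * δ := by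
  -- The weight e^{-lt} makes (α + β)/l ≤ 1/2, so half of the weighted maximum m can be absorbed on
  -- the left.
  set l := 2 * (α + β) + 1 with hl
  have hl0 : 0 < l := by positivity
  have hT : 0 ≤ T := ht.1.trans ht.2
  obtain ⟨t₀, ht₀, hmax⟩ := isCompact_Icc.exists_isMaxOn (nonempty_Icc.2 hT)
    (f := fun t => Real.exp (-(l * t)) * ‖x t‖) (by fun_prop)
  set m := Real.exp (-(l * t₀)) * ‖x t₀‖ with hm
  have hm0 : 0 ≤ m := by positivity
  have hexp : ∀ s, Real.exp (l * s) * Real.exp (-(l * s)) = 1 := fun s => by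
    rw [← Real.exp_add]
    simp
  have hxm : ∀ s ∈ Icc 0 T, ‖x s‖ ≤ Real.exp (l * s) * m := fun s hs => by
    calc ‖x s‖ = Real.exp (l * s) * (Real.exp (-(l * s)) * ‖x s‖) := by
          rw [← mul_assoc, hexp, one_mul]
      _ ≤ Real.exp (l * s) * m := by
          gcongr
          exact isMaxOn_iff.1 hmax s hs
  -- A delayed time is either in the initial interval, where δ bounds x, or in [0, s], where the
  -- weighted bound at s applies because the exponential increases.
  have hzm : ∀ s ∈ Icc 0 T, ‖x (s - ν s)‖ ≤ δ + Real.exp (l * s) * m := fun s hs => by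
    obtain ⟨h1, h2⟩ := hν s hs.1
    rcases le_total (s - ν s) 0 with h | h
    · have := hinit (s - ν s) ⟨by linarith [hs.1], h⟩
      have : 0 ≤ Real.exp (l * s) * m := by positivity
      linarith
    · have h3 := hxm (s - ν s) ⟨h, by linarith [hs.2]⟩
      have h4 : Real.exp (l * (s - ν s)) * m ≤ Real.exp (l * s) * m := by
        gcongr
        linarith
      linarith
  have hbound : ∀ s ∈ Icc 0 T, ‖r s‖ ≤ β * δ + (α + β) * m * Real.exp (l * s) := fun s hs => by
    calc ‖r s‖ ≤ α * ‖x s‖ + β * ‖x (s - ν s)‖ := hr s hs.1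
      _ ≤ α * (Real.exp (l * s) * m) + β * (δ + Real.exp (l * s) * m) := by
        gcongr
        · exact hxm s hs
        · exact hzm s hs
      _ = _ := by ring
  have hprim : ∫ s in (0 : ℝ)..t₀, (β * δ + (α + β) * m * Real.exp (l * s))
      = (β * δ * t₀ + (α + β) * m * (l⁻¹ * Real.exp (l * t₀)))
        - (β * δ * 0 + (α + β) * m * (l⁻¹ * Real.exp (l * 0))) := by
    refine integral_eq_sub_of_hasDerivAt (f := fun s => β * δ * s
      + (α + β) * m * (l⁻¹ * Real.exp (l * s))) (fun s _ => ?_)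
      (Continuous.intervalIntegrable (by fun_prop) _ _)
    have h1 : HasDerivAt (fun s => l * s) l s := by simpa using (hasDerivAt_id s).const_mul l
    have h2 := ((hasDerivAt_id s).const_mul (β * δ)).add
      ((h1.exp.const_mul l⁻¹).const_mul ((α + β) * m))
    refine h2.congr_deriv ?_
    field_simp
  have hint : ‖∫ s in (0 : ℝ)..t₀, r s‖
      ≤ ∫ s in (0 : ℝ)..t₀, (β * δ + (α + β) * m * Real.exp (l * s)) :=
    norm_integral_le_of_norm_le ht₀.1
      (Eventually.of_forall fun s hs => hbound s ⟨hs.1.le, hs.2.trans ht₀.2⟩)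
      (Continuous.intervalIntegrable (by fun_prop) _ _)
  have hx0 : ‖x 0‖ ≤ δ := hinit 0 ⟨by linarith, le_rfl⟩
  have hxt₀ : ‖x t₀‖ ≤ δ + β * δ * T + 1 / 2 * m * Real.exp (l * t₀) := by
    have h1 : ‖x t₀‖ ≤ ‖x 0‖ + ‖∫ s in (0 : ℝ)..t₀, r s‖ := by
      rw [hxr t₀ ht₀.1]
      exact norm_add_le _ _
    have h2 : (α + β) * m * (l⁻¹ * Real.exp (l * t₀)) ≤ 1 / 2 * m * Real.exp (l * t₀) := by
      have : (α + β) * l⁻¹ ≤ 1 / 2 := by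
        rw [← div_eq_mul_inv, div_le_iff₀ hl0]
        linarith
      calc _ = ((α + β) * l⁻¹) * (m * Real.exp (l * t₀)) := by ring
        _ ≤ 1 / 2 * (m * Real.exp (l * t₀)) := by gcongr
        _ = _ := by ring
    have h3 : β * δ * t₀ ≤ β * δ * T := by gcongr; exact ht₀.2
    have h4 : 0 ≤ (α + β) * m * (l⁻¹ * Real.exp (l * 0)) := by positivity
    linarith
  have hmle : m ≤ 2 * (1 + β * T) * δ := by
    have hle1 : Real.exp (-(l * t₀)) ≤ 1 := Real.exp_le_one_iff.2 (by
      have := mul_nonneg hl0.le ht₀.1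
      linarith)
    have h1 : m ≤ Real.exp (-(l * t₀)) * (δ + β * δ * T) + 1 / 2 * m := by
      calc m ≤ Real.exp (-(l * t₀)) * (δ + β * δ * T + 1 / 2 * m * Real.exp (l * t₀)) := by
            rw [hm]
            gcongr
        _ = Real.exp (-(l * t₀)) * (δ + β * δ * T)
            + 1 / 2 * m * (Real.exp (l * t₀) * Real.exp (-(l * t₀))) := by ring
        _ = _ := by rw [hexp, mul_one]
    have h2 : Real.exp (-(l * t₀)) * (δ + β * δ * T) ≤ 1 * (δ + β * δ * T) := by gcongr
    linarith
  calc ‖x t‖ ≤ Real.exp (l * t) * m := hxm t ht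
    _ ≤ Real.exp (l * T) * (2 * (1 + β * T) * δ) := by
      gcongr
      exact ht.2
    _ = _ := by ring

end Decay

/-! ### Square integrability of quadratic and linear expressions -/

section LocalIntegrability

open Set

variable {n : Type*} [Fintype n]

lemma MeasureTheory.MemLp.integrable_dotProduct_mulVec {α : Type*} [MeasurableSpace α]
    {μ : Measure α} {u : α → n → ℝ} (hu : MemLp u 2 μ) (N : Matrix n n ℝ) :
    Integrable (fun t => u t ⬝ᵥ (N *ᵥ u t)) μ := by
  simp only [dotProduct, mulVec, Finset.mul_sum]
  refine integrable_finsetSum _ fun i _ => integrable_finsetSum _ fun j _ => ?_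
  have h := ((memLp_pi_iff.1 hu i).integrable_mul (memLp_pi_iff.1 hu j)).const_mul (N i j)
  refine h.congr (Filter.Eventually.of_forall fun t => ?_)
  simp only [Pi.mul_apply]
  ring

lemma MeasureTheory.MemLp.integrable_dotProduct_self {α : Type*} [MeasurableSpace α]
    {μ : Measure α} {u : α → n → ℝ} (hu : MemLp u 2 μ) : Integrable (fun t => u t ⬝ᵥ u t) μ := by
  classical
  simpa using hu.integrable_dotProduct_mulVec 1

lemma MeasureTheory.MemLp.mulVec {m α : Type*} [Fintype m] [MeasurableSpace α]
    {μ : Measure α} {u : α → n → ℝ} (hu : MemLp u 2 μ) (N : Matrix m n ℝ) :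
    MemLp (fun t => N *ᵥ u t) 2 μ :=
  (mulVecLin N).toContinuousLinearMap.comp_memLp' hu

/-- The right-hand side of the equation is extended by zero to times t ≤ 0, so that windows reaching
back before 0 can be integrated. -/
lemma intervalIntegrable_indicator_Ioi {E : Type*} [NormedAddCommGroup E] {f : ℝ → E}
    (hf : ∀ b, IntegrableOn f (Icc 0 b)) (s t : ℝ) :
    IntervalIntegrable ((Ioi 0).indicator f) volume s t := by
  rw [intervalIntegrable_iff, IntegrableOn, integrable_indicator_iff measurableSet_Ioi, IntegrableOn,
    Measure.restrict_restrict measurableSet_Ioi]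
  refine (hf (max s t)).mono_set fun u hu => ⟨le_of_lt hu.1, ?_⟩
  rw [uIoc] at hu
  exact hu.2.2

end LocalIntegrability

/-! ### Energy inequality along solutions and the disturbance gain -/

namespace TrackingData

open Set Filter intervalIntegral

variable {np nr m dp dr q : ℕ} {S : TrackingData np nr m dp dr q}
  {Kp : Matrix (Fin m) (Fin np) ℝ} {Kr : Matrix (Fin m) (Fin nr) ℝ} {ηm κ γ : ℝ} {ν : ℝ → ℝ}
  {w : ℝ → Fin dp ⊕ Fin dr → ℝ} {x : ℝ → Fin np ⊕ Fin nr → ℝ}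

/-- The values of a solution on `(-∞, -κ)` may be changed so that it becomes continuous. -/
lemma IsSolution.exists_continuous (hx : S.IsSolution Kp Kr κ ν w x) (hκ : 0 ≤ κ)
    (hν : ∀ t, 0 ≤ t → ν t ≤ κ) :
    ∃ x' : ℝ → Fin np ⊕ Fin nr → ℝ, Continuous x' ∧ (∀ t, -κ ≤ t → x' t = x t) ∧
      S.IsSolution Kp Kr κ ν w x' := by
  have heq : ∀ t, -κ ≤ t → x (max t (-κ)) = x t := fun t ht => by rw [max_eq_left ht]
  -- Freezing the value at -κ makes the function continuous; delayed times never go below -κ, so the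
  -- equation is unaffected.
  have hc : Continuous fun t => x (max t (-κ)) :=
    hx.continuousOn.comp_continuous (by fun_prop) fun t =>
      mem_Ici.2 (le_max_right _ _)
  have hrhs : ∀ t, 0 ≤ t → S.rhs Kp Kr ν w (fun t => x (max t (-κ))) t = S.rhs Kp Kr ν w x t :=
    fun t ht => by
      rw [rhs, rhs, heq t (by linarith), heq (t - ν t) (by linarith [hν t ht])]
  refine ⟨fun t => x (max t (-κ)), hc, heq, hc.continuousOn, fun t ht => ?_, fun t ht => ?_⟩
  · refine (hx.intervalIntegrable t ht).congr fun s hs => ?_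
    rw [uIoc_of_le ht] at hs
    exact (hrhs s hs.1.le).symm
  · rw [heq t (by linarith), heq 0 (by linarith), hx.integral_eq t ht]
    congr 1
    refine integral_congr fun s hs => ?_
    rw [uIcc_of_le ht] at hs
    exact (hrhs s hs.1).symm

section Regularity

lemma memLp_of_continuous (hx : Continuous x) (b : ℝ) : MemLp x 2 (volume.restrict (Icc 0 b)) := by
  obtain ⟨C, hC⟩ := isCompact_Icc.exists_bound_of_continuousOn (s := Icc 0 b) hx.continuousOn
  refine MemLp.of_bound hx.aestronglyMeasurable C ?_
  filter_upwards [ae_restrict_mem measurableSet_Icc] with t ht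
  exact hC _ ht

variable (hν : AEMeasurable ν (volume.restrict (Ici 0)))
  (hνb : ∀ t, 0 ≤ t → 0 ≤ ν t ∧ ν t ≤ κ) (hx : Continuous x)
include hν hx

lemma aestronglyMeasurable_delayed :
    AEStronglyMeasurable (fun t => x (t - ν t)) (volume.restrict (Ici 0)) :=
  hx.comp_aestronglyMeasurable (aemeasurable_id.sub hν).aestronglyMeasurable

lemma aestronglyMeasurable_trackingError :
    AEStronglyMeasurable (S.trackingError Kp Kr ν x) (volume.restrict (Ici 0)) := by
  refine AEStronglyMeasurable.add ?_ ?_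
  · exact Continuous.aestronglyMeasurable (by fun_prop)
  · exact (Continuous.matrix_mulVec continuous_const continuous_id).comp_aestronglyMeasurable
      (aestronglyMeasurable_delayed hν hx)

include hνb

lemma memLp_delayed (b : ℝ) :
    MemLp (fun t => x (t - ν t)) 2 (volume.restrict (Icc 0 b)) := by
  obtain ⟨C, hC⟩ := isCompact_Icc.exists_bound_of_continuousOn (s := Icc (-κ) b) hx.continuousOn
  refine MemLp.of_bound ((aestronglyMeasurable_delayed hν hx).mono_measure
    (Measure.restrict_mono Icc_subset_Ici_self le_rfl)) C ?_
  filter_upwards [ae_restrict_mem measurableSet_Icc] with t ht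
  obtain ⟨h1, h2⟩ := hνb t ht.1
  exact hC _ ⟨by linarith [ht.1], by linarith [ht.2]⟩

lemma memLp_trackingError (b : ℝ) :
    MemLp (S.trackingError Kp Kr ν x) 2 (volume.restrict (Icc 0 b)) :=
  ((memLp_of_continuous hx b).mulVec S.CBar).add ((memLp_delayed hν hνb hx b).mulVec _)

lemma memLp_rhs (hw : MemLp w 2 (volume.restrict (Ici 0))) (b : ℝ) :
    MemLp (S.rhs Kp Kr ν w x) 2 (volume.restrict (Icc 0 b)) :=
  (((memLp_of_continuous hx b).mulVec S.ABar).add ((memLp_delayed hν hνb hx b).mulVec _)).add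
    ((hw.mono_measure (Measure.restrict_mono Icc_subset_Ici_self le_rfl)).mulVec _)

end Regularity

/-- The dissipation inequality integrated along a solution from `a` to `T`. -/
lemma Dissipative.energy_inequality {c a T : ℝ}
    {X Qh R₁ R₂ : Matrix (Fin np ⊕ Fin nr) (Fin np ⊕ Fin nr) ℝ}
    (hS : S.Dissipative Kp Kr ηm κ γ c X Qh R₁ R₂)
    (hX : X.PosDef) (hQ : Qh.PosDef) (hR₁ : R₁.PosDef) (hR₂ : R₂.PosDef)
    (hηm : 0 < ηm) (hηκ : ηm ≤ κ) (hν : AEMeasurable ν (volume.restrict (Ici 0)))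
    (hνb : ∀ t, 0 ≤ t → ηm ≤ ν t ∧ ν t ≤ κ) (hx : Continuous x)
    (hw : MemLp w 2 (volume.restrict (Ici 0))) (ha : 0 ≤ a) (haT : a ≤ T)
    (hxg : ∀ s t, a - κ ≤ s → a - κ ≤ t →
      x t - x s = ∫ τ in s..t, (Ioi 0).indicator (S.rhs Kp Kr ν w x) τ) :
    x T ⬝ᵥ (X *ᵥ x T) + c * (∫ t in a..T, ‖x t‖ ^ 2) + c * (∫ t in a..T, ‖w t‖ ^ 2)
      + (∫ t in a..T, S.trackingError Kp Kr ν x t ⬝ᵥ S.trackingError Kp Kr ν x t)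
      - γ ^ 2 * (∫ t in a..T, w t ⬝ᵥ w t) ≤ x a ⬝ᵥ (X *ᵥ x a)
      + (∫ t in (a - ηm)..a, x t ⬝ᵥ (Qh *ᵥ x t))
      + ηm * (∫ t in (a - ηm)..a, (Ioi 0).indicator (S.rhs Kp Kr ν w x) t ⬝ᵥ
          (R₁ *ᵥ (Ioi 0).indicator (S.rhs Kp Kr ν w x) t))
      + κ * (∫ t in (a - κ)..a, (Ioi 0).indicator (S.rhs Kp Kr ν w x) t ⬝ᵥ
          (R₂ *ᵥ (Ioi 0).indicator (S.rhs Kp Kr ν w x) t)) := by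
  have hνb' : ∀ t, 0 ≤ t → 0 ≤ ν t ∧ ν t ≤ κ := fun t ht =>
    ⟨hηm.le.trans (hνb t ht).1, (hνb t ht).2⟩
  have hL2 : ∀ b, MemLp (S.rhs Kp Kr ν w x) 2 (volume.restrict (Icc 0 b)) :=
    memLp_rhs hν hνb' hx hw
  have hg : ∀ s t, IntervalIntegrable ((Ioi 0).indicator (S.rhs Kp Kr ν w x)) volume s t :=
    intervalIntegrable_indicator_Ioi fun b => (hL2 b).integrable one_le_two
  have hφ : ∀ (R : Matrix (Fin np ⊕ Fin nr) (Fin np ⊕ Fin nr) ℝ) (s t : ℝ), IntervalIntegrable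
      (fun τ => (Ioi 0).indicator (S.rhs Kp Kr ν w x) τ ⬝ᵥ
        (R *ᵥ (Ioi 0).indicator (S.rhs Kp Kr ν w x) τ)) volume s t := by
    intro R s t
    have := intervalIntegrable_indicator_Ioi
      (fun b => (hL2 b).integrable_dotProduct_mulVec R) s t
    refine this.congr fun τ _ => ?_
    by_cases hτ : τ ∈ Ioi (0 : ℝ) <;> simp [hτ]
  have hloc : ∀ {f : ℝ → ℝ}, (∀ b, IntegrableOn f (Icc 0 b)) → IntervalIntegrable f volume a T :=
    fun {f} hf => by
      rw [intervalIntegrable_iff, uIoc_of_le haT]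
      exact (hf T).mono_set fun u hu => ⟨ha.trans hu.1.le, hu.2⟩
  have hwL2 : ∀ b, MemLp w 2 (volume.restrict (Icc 0 b)) := fun b =>
    hw.mono_measure (Measure.restrict_mono Icc_subset_Ici_self le_rfl)
  have i1 : IntervalIntegrable (fun t => ‖x t‖ ^ 2) volume a T :=
    Continuous.intervalIntegrable (by fun_prop) _ _
  have i2 : IntervalIntegrable (fun t => ‖w t‖ ^ 2) volume a T :=
    hloc fun b => (hwL2 b).norm.integrable_sq
  have i3 : IntervalIntegrable
      (fun t => S.trackingError Kp Kr ν x t ⬝ᵥ S.trackingError Kp Kr ν x t) volume a T :=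
    hloc fun b => (memLp_trackingError hν hνb' hx b).integrable_dotProduct_self
  have i4 : IntervalIntegrable (fun t => w t ⬝ᵥ w t) volume a T :=
    hloc fun b => (hwL2 b).integrable_dotProduct_self
  have main := lyapunovKrasovskii_energy_inequality (ν := ν)
    (s := fun t => c * ‖x t‖ ^ 2 + c * ‖w t‖ ^ 2
    + S.trackingError Kp Kr ν x t ⬝ᵥ S.trackingError Kp Kr ν x t - γ ^ 2 * w t ⬝ᵥ w t)
    haT hηm hηκ hX hQ hR₁ hR₂ hx hg (hφ R₁) (hφ R₂) hxg (fun t ht => hνb t (ha.trans ht))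
    ((((i1.const_mul c).add (i2.const_mul c)).add i3).sub (i4.const_mul _)) (fun t ht => by
      have ht0 : t ∈ Ioi (0 : ℝ) := ha.trans_lt ht
      rw [indicator_of_mem ht0]
      exact hS (x t) (x (t - ηm)) (x (t - ν t)) _ (w t) _ rfl rfl)
  rw [intervalIntegral.integral_sub (((i1.const_mul c).add (i2.const_mul c)).add i3)
      (i4.const_mul _), intervalIntegral.integral_add ((i1.const_mul c).add (i2.const_mul c)) i3,
    intervalIntegral.integral_add (i1.const_mul c) (i2.const_mul c),
    intervalIntegral.integral_const_mul, intervalIntegral.integral_const_mul,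
    intervalIntegral.integral_const_mul] at main
  linarith

/-- The disturbance attenuation part of the tracking performance. -/
lemma Dissipative.l2_gain {c : ℝ}
    {X Qh R₁ R₂ : Matrix (Fin np ⊕ Fin nr) (Fin np ⊕ Fin nr) ℝ} (hc : 0 < c)
    (hS : S.Dissipative Kp Kr ηm κ γ c X Qh R₁ R₂)
    (hX : X.PosDef) (hQ : Qh.PosDef) (hR₁ : R₁.PosDef) (hR₂ : R₂.PosDef)
    (hηm : 0 < ηm) (hηκ : ηm ≤ κ) (hν : AEMeasurable ν (volume.restrict (Ici 0)))
    (hνb : ∀ t, 0 ≤ t → ηm ≤ ν t ∧ ν t ≤ κ) (hx : Continuous x)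
    (hw : MemLp w 2 (volume.restrict (Ici 0))) (hsol : S.IsSolution Kp Kr κ ν w x)
    (hinit : ∀ t ∈ Icc (-κ) 0, x t = 0) :
    MemLp (S.trackingError Kp Kr ν x) 2 (volume.restrict (Ici 0)) ∧
    (¬ w =ᵐ[volume.restrict (Ici 0)] 0 →
      ∫ t in Ici (0 : ℝ), S.trackingError Kp Kr ν x t ⬝ᵥ S.trackingError Kp Kr ν x t
        < γ ^ 2 * ∫ t in Ici (0 : ℝ), w t ⬝ᵥ w t) := by
  have hκ : 0 < κ := hηm.trans_le hηκ
  have hνb' : ∀ t, 0 ≤ t → 0 ≤ ν t ∧ ν t ≤ κ := fun t ht =>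
    ⟨hηm.le.trans (hνb t ht).1, (hνb t ht).2⟩
  set g := (Ioi 0).indicator (S.rhs Kp Kr ν w x) with hgdef
  have hg : ∀ s t, IntervalIntegrable g volume s t :=
    intervalIntegrable_indicator_Ioi fun b => (memLp_rhs hν hνb' hx hw b).integrable one_le_two
  have hg0 : ∀ t, t ≤ 0 → g t = 0 := fun t ht => indicator_of_notMem (not_lt.2 ht) _
  have hx0 : x 0 = 0 := hinit 0 ⟨by linarith, le_rfl⟩
  -- Zero initial data make x a primitive of the extended g on all of [-κ, ∞), which permits the
  -- base point a = 0, where all starting terms vanish.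
  have hprim : ∀ t, -κ ≤ t → x t = ∫ τ in (0 : ℝ)..t, g τ := by
    intro t ht
    rcases le_total 0 t with h | h
    · rw [hsol.integral_eq t h, hx0, zero_add]
      refine integral_congr_ae (Eventually.of_forall fun τ hτ => ?_)
      rw [uIoc_of_le h] at hτ
      exact (indicator_of_mem (show τ ∈ Ioi (0 : ℝ) from hτ.1) _).symm
    · rw [hinit t ⟨ht, h⟩, integral_congr (g := fun _ => 0), intervalIntegral.integral_zero]
      intro τ hτ
      rw [uIcc_of_ge h] at hτ
      exact hg0 τ hτ.2
  have henergy : ∀ T, 0 ≤ T →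
      c * (∫ t in (0 : ℝ)..T, ‖w t‖ ^ 2)
      + (∫ t in (0 : ℝ)..T, S.trackingError Kp Kr ν x t ⬝ᵥ S.trackingError Kp Kr ν x t)
      - γ ^ 2 * (∫ t in (0 : ℝ)..T, w t ⬝ᵥ w t) ≤ 0 := by
    intro T hT
    have h := hS.energy_inequality hX hQ hR₁ hR₂ hηm hηκ hν hνb hx hw le_rfl hT
      (fun s t hs ht => by
        rw [hprim t (by linarith), hprim s (by linarith)]
        exact integral_interval_sub_left (hg _ _) (hg _ _))
    rw [← hgdef] at h
    have z1 : ∫ t in (0 - ηm)..0, x t ⬝ᵥ (Qh *ᵥ x t) = 0 := by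
      rw [integral_congr (g := fun _ => 0), intervalIntegral.integral_zero]
      intro t ht
      rw [uIcc_of_le (by linarith)] at ht
      simp [hinit t ⟨by linarith [ht.1], ht.2⟩]
    have z2 : ∀ (R : Matrix (Fin np ⊕ Fin nr) (Fin np ⊕ Fin nr) ℝ) (r : ℝ), 0 ≤ r →
        ∫ t in (0 - r)..0, g t ⬝ᵥ (R *ᵥ g t) = 0 := by
      intro R r hr
      rw [integral_congr (g := fun _ => 0), intervalIntegral.integral_zero]
      intro t ht
      rw [uIcc_of_le (by linarith)] at ht
      simp [hg0 t ht.2]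
    rw [z1, z2 _ _ hηm.le, z2 _ _ hκ.le, hx0] at h
    have p1 := hX.dotProduct_mulVec_nonneg' (x T)
    have p2 : 0 ≤ c * ∫ t in (0 : ℝ)..T, ‖x t‖ ^ 2 :=
      mul_nonneg hc.le (integral_nonneg hT fun t _ => by positivity)
    simp only [zero_dotProduct, mul_zero, add_zero] at h
    linarith
  set e := S.trackingError Kp Kr ν x with hedef
  have hw1 : IntegrableOn (fun t => w t ⬝ᵥ w t) (Ioi 0) :=
    IntegrableOn.mono_set hw.integrable_dotProduct_self Ioi_subset_Ici_self
  have hw2 : IntegrableOn (fun t => ‖w t‖ ^ 2) (Ioi 0) :=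
    IntegrableOn.mono_set hw.norm.integrable_sq Ioi_subset_Ici_self
  have hdot : ∀ {k : ℕ} (v : Fin k → ℝ), 0 ≤ v ⬝ᵥ v := fun v =>
    (sq_nonneg ‖v‖).trans (norm_sq_le_dotProduct_self v)
  have hdotw : ∀ t, 0 ≤ w t ⬝ᵥ w t := fun t =>
    (sq_nonneg ‖w t‖).trans (norm_sq_le_dotProduct_self (w t))
  have hee : IntegrableOn (fun t => e t ⬝ᵥ e t) (Ioi 0) := by
    refine integrableOn_Ioi_of_intervalIntegral_norm_bounded (b := fun T : ℝ => T) (l := atTop)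
      (γ ^ 2 * ∫ t in Ioi (0 : ℝ), w t ⬝ᵥ w t) 0 (fun T => ?_) tendsto_id ?_
    · exact IntegrableOn.mono_set (memLp_trackingError hν hνb' hx T).integrable_dotProduct_self
        Ioc_subset_Icc_self
    · filter_upwards [eventually_ge_atTop 0] with T hT
      have h := henergy T hT
      have h1 : ∫ t in (0 : ℝ)..T, w t ⬝ᵥ w t ≤ ∫ t in Ioi (0 : ℝ), w t ⬝ᵥ w t := by
        rw [integral_of_le hT]
        exact setIntegral_mono_set hw1 (Eventually.of_forall hdotw)
          (LE.le.eventuallyLE Ioc_subset_Ioi_self)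
      have h2 : 0 ≤ c * ∫ t in (0 : ℝ)..T, ‖w t‖ ^ 2 :=
        mul_nonneg hc.le (integral_nonneg hT fun t _ => by positivity)
      have h3 := mul_le_mul_of_nonneg_left h1 (sq_nonneg γ)
      simp only [Real.norm_of_nonneg (hdot _)]
      linarith
  have hmeas : AEStronglyMeasurable e (volume.restrict (Ici 0)) :=
    aestronglyMeasurable_trackingError hν hx
  refine ⟨?_, fun hw0 => ?_⟩
  · rw [memLp_two_iff_integrable_sq_norm hmeas]
    refine Integrable.mono' ((integrableOn_Ici_iff_integrableOn_Ioi (by simp)).2 hee)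
      (hmeas.norm.pow 2)
      (Eventually.of_forall fun t => ?_)
    rw [Real.norm_of_nonneg (sq_nonneg _)]
    exact norm_sq_le_dotProduct_self (e t)
  · rw [integral_Ici_eq_integral_Ioi, integral_Ici_eq_integral_Ioi]
    have hlim : Tendsto (fun T : ℝ => c * (∫ t in (0 : ℝ)..T, ‖w t‖ ^ 2)
        + (∫ t in (0 : ℝ)..T, e t ⬝ᵥ e t) - γ ^ 2 * (∫ t in (0 : ℝ)..T, w t ⬝ᵥ w t)) atTop
        (nhds (c * (∫ t in Ioi (0 : ℝ), ‖w t‖ ^ 2) + (∫ t in Ioi (0 : ℝ), e t ⬝ᵥ e t)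
          - γ ^ 2 * ∫ t in Ioi (0 : ℝ), w t ⬝ᵥ w t)) :=
      (((intervalIntegral_tendsto_integral_Ioi 0 hw2 tendsto_id).const_mul c).add
        (intervalIntegral_tendsto_integral_Ioi 0 hee tendsto_id)).sub
        ((intervalIntegral_tendsto_integral_Ioi 0 hw1 tendsto_id).const_mul _)
    have hle := le_of_tendsto hlim (by
      filter_upwards [eventually_ge_atTop 0] with T hT using henergy T hT)
    -- The limit T → ∞ only preserves a weak inequality; the strict one comes from the margin c∫‖w‖²
    -- > 0.
    have hpos : 0 < ∫ t in Ioi (0 : ℝ), ‖w t‖ ^ 2 := by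
      refine lt_of_le_of_ne (integral_nonneg fun t => by positivity) fun h0 => hw0 ?_
      rw [eq_comm, integral_eq_zero_iff_of_nonneg (fun t => by positivity) hw2] at h0
      rw [← Measure.restrict_congr_set Ioi_ae_eq_Ici]
      filter_upwards [h0] with t ht
      simpa using ht
    have := mul_pos hc hpos
    linarith

end TrackingData

/-! ### Asymptotic stability without disturbance -/

namespace TrackingData

open Set Filter intervalIntegral

variable {np nr m dp dr q : ℕ} {S : TrackingData np nr m dp dr q}
  {Kp : Matrix (Fin m) (Fin np) ℝ} {Kr : Matrix (Fin m) (Fin nr) ℝ} {ηm κ γ : ℝ} {ν : ℝ → ℝ}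

variable (S Kp Kr) in
lemma exists_norm_rhs_zero_le : ∃ α β : ℝ, 0 ≤ α ∧ 0 ≤ β ∧
    ∀ (ν : ℝ → ℝ) (x : ℝ → Fin np ⊕ Fin nr → ℝ) (t : ℝ),
      ‖S.rhs Kp Kr ν 0 x t‖ ≤ α * ‖x t‖ + β * ‖x (t - ν t)‖ := by
  obtain ⟨α, hα, hA⟩ := exists_norm_mulVec_le S.ABar
  obtain ⟨β, hβ, hB⟩ := exists_norm_mulVec_le (S.BBar Kp Kr)
  refine ⟨α, β, hα, hβ, fun ν x t => ?_⟩
  rw [rhs, Pi.zero_apply, mulVec_zero, add_zero]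
  exact (norm_add_le _ _).trans (add_le_add (hA _) (hB _))

/-- Undisturbed solutions are bounded, uniformly and in `L²`, in terms of the initial function. -/
lemma Dissipative.exists_bound {c : ℝ}
    {X Qh R₁ R₂ : Matrix (Fin np ⊕ Fin nr) (Fin np ⊕ Fin nr) ℝ} (hc : 0 < c)
    (hS : S.Dissipative Kp Kr ηm κ γ c X Qh R₁ R₂)
    (hX : X.PosDef) (hQ : Qh.PosDef) (hR₁ : R₁.PosDef) (hR₂ : R₂.PosDef)
    (hηm : 0 < ηm) (hηκ : ηm ≤ κ) (hν : AEMeasurable ν (volume.restrict (Ici 0)))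
    (hνb : ∀ t, 0 ≤ t → ηm ≤ ν t ∧ ν t ≤ κ) :
    ∃ C : ℝ, 0 ≤ C ∧ ∀ (x : ℝ → Fin np ⊕ Fin nr → ℝ) (δ : ℝ), Continuous x →
      S.IsSolution Kp Kr κ ν 0 x → 0 ≤ δ → (∀ t ∈ Icc (-κ) 0, ‖x t‖ ≤ δ) →
      (∀ t, -κ ≤ t → ‖x t‖ ≤ C * δ) ∧ ∀ T, κ ≤ T → ∫ t in κ..T, ‖x t‖ ^ 2 ≤ C * δ ^ 2 := by
  have hκ : 0 < κ := hηm.trans_le hηκ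
  have hνb' : ∀ t, 0 ≤ t → 0 ≤ ν t ∧ ν t ≤ κ := fun t ht =>
    ⟨hηm.le.trans (hνb t ht).1, (hνb t ht).2⟩
  obtain ⟨α, β, hα, hβ, hrhs⟩ := exists_norm_rhs_zero_le S Kp Kr
  obtain ⟨cX, hcX, hXcoer⟩ := hX.exists_coercive
  obtain ⟨CX, hCX0, hCX⟩ := exists_abs_dotProduct_mulVec_le X
  obtain ⟨CQ, hCQ0, hCQ⟩ := exists_abs_dotProduct_mulVec_le Qh
  obtain ⟨C₁, hC₁0, hC₁⟩ := exists_abs_dotProduct_mulVec_le R₁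
  obtain ⟨C₂, hC₂0, hC₂⟩ := exists_abs_dotProduct_mulVec_le R₂
  -- The Grönwall factor on [0, κ]; the added 1 covers the initial interval as well.
  set B := 2 * (1 + β * κ) * Real.exp ((2 * (α + β) + 1) * κ) + 1 with hB
  have hB0 : 0 ≤ B := by positivity
  -- D δ² bounds the four starting terms of the energy inequality at a = κ, using ‖x‖ ≤ Bδ and ‖ẋ‖ ≤
  -- (α + β)Bδ.
  set D := CX * B ^ 2 + ηm * (CQ * B ^ 2) + ηm * (ηm * (C₁ * ((α + β) * B) ^ 2))
    + κ * (κ * (C₂ * ((α + β) * B) ^ 2)) with hD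
  have hD0 : 0 ≤ D := by positivity
  -- The summands serve, in order, the times up to κ, the later times, and the L² bound.
  refine ⟨B + √(D / cX) + D / c, by positivity, fun x δ hx hsol hδ hinit => ?_⟩
  have hearly : ∀ t ∈ Icc (-κ) κ, ‖x t‖ ≤ B * δ := by
    intro t ht
    have hEδ : 0 ≤ 2 * (1 + β * κ) * Real.exp ((2 * (α + β) + 1) * κ) * δ := by positivity
    rcases le_total t 0 with h | h
    · have := hinit t ⟨ht.1, h⟩
      rw [hB]
      linarith
    · have := norm_le_of_delay_inequality hα hβ hδ hκ.le hx hsol.integral_eq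
        (fun s _ => hrhs ν x s) hνb' hinit (T := κ) ⟨h, ht.2⟩
      rw [hB]
      linarith
  have hgb : ∀ t ∈ Icc 0 κ,
      ‖(Ioi 0).indicator (S.rhs Kp Kr ν 0 x) t‖ ≤ (α + β) * B * δ := fun t ht => by
    obtain ⟨h1, h2⟩ := hνb' t ht.1
    calc _ ≤ ‖S.rhs Kp Kr ν 0 x t‖ := norm_indicator_le_norm_self _ _
      _ ≤ α * ‖x t‖ + β * ‖x (t - ν t)‖ := hrhs ν x t
      _ ≤ α * (B * δ) + β * (B * δ) := by
        gcongr
        · exact hearly t ⟨by linarith [ht.1], ht.2⟩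
        · exact hearly _ ⟨by linarith [ht.1], by linarith [ht.2]⟩
      _ = (α + β) * B * δ := by ring
  have hquad : ∀ {N : Matrix (Fin np ⊕ Fin nr) (Fin np ⊕ Fin nr) ℝ} {CN r : ℝ}
      {u : Fin np ⊕ Fin nr → ℝ}, 0 ≤ CN →
      (∀ u v : Fin np ⊕ Fin nr → ℝ, |u ⬝ᵥ (N *ᵥ v)| ≤ CN * (‖u‖ * ‖v‖)) → ‖u‖ ≤ r →
      |u ⬝ᵥ (N *ᵥ u)| ≤ CN * r ^ 2 := by
    intro N CN r u hCN hN hu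
    calc |u ⬝ᵥ (N *ᵥ u)| ≤ CN * (‖u‖ * ‖u‖) := hN u u
      _ = CN * ‖u‖ ^ 2 := by ring
      _ ≤ CN * r ^ 2 := by gcongr
  have hwin : ∀ {φ : ℝ → ℝ} {h M : ℝ}, 0 ≤ h → h ≤ κ → (∀ t ∈ Icc 0 κ, |φ t| ≤ M) →
      ∫ t in (κ - h)..κ, φ t ≤ h * M := by
    intro φ h M h0 hhκ hM
    have := norm_integral_le_of_norm_le_const (a := κ - h) (b := κ) (f := φ) (C := M)
      fun t ht => by
        rw [uIoc_of_le (by linarith)] at ht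
        exact hM t ⟨by linarith [ht.1], ht.2⟩
    rw [sub_sub_cancel, abs_of_nonneg h0, mul_comm] at this
    exact (le_abs_self _).trans this
  -- From a = κ the windows reach back only to 0, so the initial function need not be
  -- differentiable.
  have hxg : ∀ s t, κ - κ ≤ s → κ - κ ≤ t →
      x t - x s = ∫ τ in s..t, (Ioi 0).indicator (S.rhs Kp Kr ν 0 x) τ := by
    have hw : MemLp (0 : ℝ → Fin dp ⊕ Fin dr → ℝ) 2 (volume.restrict (Ici 0)) := MemLp.zero
    have hg : ∀ s t, IntervalIntegrable ((Ioi 0).indicator (S.rhs Kp Kr ν 0 x)) volume s t :=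
      intervalIntegrable_indicator_Ioi fun b => (memLp_rhs hν hνb' hx hw b).integrable one_le_two
    have hprim : ∀ t, 0 ≤ t →
        x t = x 0 + ∫ τ in (0 : ℝ)..t, (Ioi 0).indicator (S.rhs Kp Kr ν 0 x) τ := by
      intro t h
      rw [hsol.integral_eq t h]
      congr 1
      refine integral_congr_ae (Eventually.of_forall fun τ hτ => ?_)
      rw [uIoc_of_le h] at hτ
      exact (indicator_of_mem (show τ ∈ Ioi (0 : ℝ) from hτ.1) _).symm
    intro s t hs ht
    rw [sub_self] at hs ht
    rw [hprim t ht, hprim s hs, add_sub_add_left_eq_sub]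
    exact integral_interval_sub_left (hg _ _) (hg _ _)
  have henergy : ∀ T, κ ≤ T → x T ⬝ᵥ (X *ᵥ x T) + c * (∫ t in κ..T, ‖x t‖ ^ 2) ≤ D * δ ^ 2 := by
    intro T hT
    have h := hS.energy_inequality hX hQ hR₁ hR₂ hηm hηκ hν hνb hx MemLp.zero hκ.le hT hxg
    have p1 : 0 ≤ ∫ t in κ..T, S.trackingError Kp Kr ν x t ⬝ᵥ S.trackingError Kp Kr ν x t :=
      integral_nonneg hT fun t _ => (sq_nonneg _).trans (norm_sq_le_dotProduct_self _)
    have k1 := hwin hηm.le hηκ fun t ht =>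
      hquad hCQ0 hCQ (hearly t ⟨by linarith [ht.1], ht.2⟩)
    have k2 := hwin hηm.le hηκ fun t ht => hquad hC₁0 hC₁ (hgb t ht)
    have k3 := hwin hκ.le le_rfl fun t ht => hquad hC₂0 hC₂ (hgb t ht)
    have k0 := (le_abs_self _).trans (hquad hCX0 hCX (hearly κ ⟨by linarith, le_rfl⟩))
    have k2' := mul_le_mul_of_nonneg_left k2 hηm.le
    have k3' := mul_le_mul_of_nonneg_left k3 hκ.le
    simp only [Pi.zero_apply, norm_zero, dotProduct_zero, intervalIntegral.integral_zero, ne_eq,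
      OfNat.ofNat_ne_zero, not_false_eq_true, zero_pow, mul_zero, add_zero, sub_zero] at h
    have hDδ : D * δ ^ 2 = CX * (B * δ) ^ 2 + ηm * (CQ * (B * δ) ^ 2)
        + ηm * (ηm * (C₁ * ((α + β) * B * δ) ^ 2))
        + κ * (κ * (C₂ * ((α + β) * B * δ) ^ 2)) := by
      rw [hD]
      ring
    linarith
  refine ⟨fun t ht => ?_, fun T hT => ?_⟩
  · rcases le_total t κ with h | h
    · refine (hearly t ⟨ht, h⟩).trans ?_
      gcongr
      have : 0 ≤ √(D / cX) := Real.sqrt_nonneg _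
      have : 0 ≤ D / c := by positivity
      linarith
    · have h1 := henergy t h
      have h2 : 0 ≤ c * ∫ s in κ..t, ‖x s‖ ^ 2 :=
        mul_nonneg hc.le (integral_nonneg h fun s _ => by positivity)
      have h3 : ‖x t‖ ^ 2 ≤ D / cX * δ ^ 2 := by
        rw [div_mul_eq_mul_div, le_div_iff₀ hcX]
        linarith [hXcoer (x t)]
      have h4 : ‖x t‖ ≤ √(D / cX) * δ := by
        refine abs_le_of_sq_le_sq' ?_ (by positivity) |>.2
        rwa [mul_pow, Real.sq_sqrt (by positivity)]
      refine h4.trans ?_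
      gcongr
      have : 0 ≤ D / c := by positivity
      linarith
  · have h1 := henergy T hT
    have h2 := hX.dotProduct_mulVec_nonneg' (x T)
    have h3 : ∫ t in κ..T, ‖x t‖ ^ 2 ≤ D / c * δ ^ 2 := by
      rw [div_mul_eq_mul_div, le_div_iff₀ hc]
      linarith
    refine h3.trans ?_
    gcongr
    have : 0 ≤ √(D / cX) := Real.sqrt_nonneg _
    linarith

lemma Dissipative.asymptoticallyStable {c : ℝ}
    {X Qh R₁ R₂ : Matrix (Fin np ⊕ Fin nr) (Fin np ⊕ Fin nr) ℝ} (hc : 0 < c)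
    (hS : S.Dissipative Kp Kr ηm κ γ c X Qh R₁ R₂)
    (hX : X.PosDef) (hQ : Qh.PosDef) (hR₁ : R₁.PosDef) (hR₂ : R₂.PosDef)
    (hηm : 0 < ηm) (hηκ : ηm ≤ κ) (hν : AEMeasurable ν (volume.restrict (Ici 0)))
    (hνb : ∀ t, 0 ≤ t → ηm ≤ ν t ∧ ν t ≤ κ) : S.AsymptoticallyStable Kp Kr κ ν := by
  have hκ : 0 < κ := hηm.trans_le hηκ
  obtain ⟨C, hC0, hC⟩ := hS.exists_bound hc hX hQ hR₁ hR₂ hηm hηκ hν hνb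
  refine ⟨fun ε hε => ⟨ε / (C + 1), by positivity, fun x hsol hinit t ht => ?_⟩, fun x hsol => ?_⟩
  · obtain ⟨x', hx', heq, hsol'⟩ := hsol.exists_continuous hκ.le fun t ht => (hνb t ht).2
    have h := (hC x' (ε / (C + 1)) hx' hsol' (by positivity) fun s hs => by
      rw [heq s hs.1]
      exact (hinit s hs).le).1 t (by linarith)
    rw [heq t (by linarith)] at h
    refine h.trans_lt ?_
    rw [mul_div_assoc', div_lt_iff₀ (by positivity)]
    linarith
  · obtain ⟨x', hx', heq, hsol'⟩ := hsol.exists_continuous hκ.le fun t ht => (hνb t ht).2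
    obtain ⟨δ, hδ⟩ := isCompact_Icc.exists_bound_of_continuousOn (s := Icc (-κ) 0) hx'.continuousOn
    have hδ0 : 0 ≤ δ := (norm_nonneg _).trans (hδ 0 ⟨by linarith, le_rfl⟩)
    obtain ⟨hb, hI⟩ := hC x' δ hx' hsol' hδ0 hδ
    obtain ⟨α, β, hα, hβ, hrhs⟩ := exists_norm_rhs_zero_le S Kp Kr
    -- The uniform bound on the state bounds its derivative; together with the L² bound this is what
    -- Barbalat's argument needs.
    have hlip : ∀ s t, κ ≤ s → s ≤ t → ‖x' t - x' s‖ ≤ (α + β) * (C * δ) * (t - s) := by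
      intro s t hs hst
      have h1 : x' t - x' s = ∫ τ in s..t, S.rhs Kp Kr ν 0 x' τ := by
        rw [hsol'.integral_eq t (by linarith), hsol'.integral_eq s (by linarith),
          add_sub_add_left_eq_sub]
        exact integral_interval_sub_left (hsol'.intervalIntegrable t (by linarith))
          (hsol'.intervalIntegrable s (by linarith))
      rw [h1, ← abs_of_nonneg (sub_nonneg.2 hst)]
      refine norm_integral_le_of_norm_le_const fun τ hτ => ?_
      rw [uIoc_of_le hst] at hτ
      have hντ := hνb τ (by linarith [hτ.1])
      calc _ ≤ α * ‖x' τ‖ + β * ‖x' (τ - ν τ)‖ := hrhs ν x' τ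
        _ ≤ α * (C * δ) + β * (C * δ) := by
          gcongr
          · exact hb τ (by linarith [hτ.1])
          · exact hb _ (by linarith [hτ.1])
        _ = _ := by ring
    refine (tendsto_zero_of_lipschitz_of_integral_bounded (by positivity) hx' hlip hI).congr' ?_
    filter_upwards [eventually_ge_atTop (-κ)] with t ht using heq t ht

end TrackingData

theorem theorem1 {np nr m dp dr q : ℕ} (S : TrackingData np nr m dp dr q)
    (ηm κ γ : ℝ) (hηm : 0 < ηm) (hηκ : ηm ≤ κ) (hγ : 0 < γ)
    (P Q M₁ M₂ U₁ U₂ V₁ V₂ : Matrix (Fin np ⊕ Fin nr) (Fin np ⊕ Fin nr) ℝ)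
    (K : Matrix (Fin m) (Fin np ⊕ Fin nr) ℝ)
    (hP : P.PosDef) (hQ : Q.PosDef) (hM₁ : M₁.PosDef) (hM₂ : M₂.PosDef)
    (hLMI : (-(S.lmiMatrix ηm κ γ P Q M₁ M₂ U₁ U₂ V₁ V₂ K)).PosDef)
    (Kp : Matrix (Fin m) (Fin np) ℝ) (Kr : Matrix (Fin m) (Fin nr) ℝ)
    (hK : Matrix.fromCols Kp Kr = K * P⁻¹)
    (ν : ℝ → ℝ) (hν : AEMeasurable ν (volume.restrict (Set.Ici 0)))
    (hνb : ∀ t, 0 ≤ t → ηm ≤ ν t ∧ ν t ≤ κ) :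
    S.HasTrackingPerformance Kp Kr κ ν γ := by
  have hκ : 0 < κ := hηm.trans_le hηκ
  obtain ⟨c, hc, hS⟩ := S.exists_dissipative hηm hκ hP hM₁ hM₂ hLMI hK
  -- A congruence of Q by the invertible symmetric matrix P⁻¹.
  have hQh : (P⁻¹ * Q * P⁻¹).PosDef := by
    have h := hQ.conjTranspose_mul_mul_same (B := P⁻¹)
      (mulVec_injective_of_isUnit hP.inv.isUnit)
    rwa [hP.inv.isHermitian.eq] at h
  refine ⟨hS.asymptoticallyStable hc hP.inv hQh hM₁.inv hM₂.inv hηm hηκ hν hνb,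
    fun w x hw hsol hinit => ?_⟩
  obtain ⟨x', hx', heq, hsol'⟩ := hsol.exists_continuous hκ.le fun t ht => (hνb t ht).2
  have herr : ∀ t ∈ Set.Ici (0 : ℝ),
      S.trackingError Kp Kr ν x' t = S.trackingError Kp Kr ν x t := fun t ht => by
    have h0 : 0 ≤ t := ht
    rw [TrackingData.trackingError, TrackingData.trackingError, heq t (by linarith),
      heq (t - ν t) (by linarith [(hνb t h0).2])]
  obtain ⟨h1, h2⟩ := hS.l2_gain hc hP.inv hQh hM₁.inv hM₂.inv hηm hηκ hν hνb hx' hw hsol'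
    fun t ht => by rw [heq t ht.1, hinit t ht]
  refine ⟨h1.ae_eq ((ae_restrict_iff' measurableSet_Ici).2 (Filter.Eventually.of_forall herr)),
    fun hw0 => ?_⟩
  have h := h2 hw0
  rwa [setIntegral_congr_fun measurableSet_Ici
    (g := fun t => S.trackingError Kp Kr ν x t ⬝ᵥ S.trackingError Kp Kr ν x t)
    fun t ht => by simp only [herr t ht]] at h
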